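/- Let $\Theta\subseteq\mathbb R^d$ be measurable, and for $\theta\in\Theta$ let $p(\cdot\mid\theta)$ be a probability density on $\mathbb R^p$ (with respect to Lebesgue measure), jointly measurable in $(y,\theta)$. For $n\ge 1$ write $p_\theta^{(n)}(y_1,\dots,y_n)=\prod_{i=1}^n p(y_i\mid\theta)$ for the density, and $P_\theta^{(n)}$ for the law, of $n$ i.i.d. observations $Y^{(n)}=(Y_1,\dots,Y_n)$. Let $P_\theta$ be a prior on $\Theta$ with Lebesgue density $p_\theta$, let $\theta^*\in\Theta$ be the true parameter, and let $\alpha\in(0,1)$. Define: - $D(P\|Q)=\int\log\frac{dP}{dQ}\,dP$ and $V(P\|Q)=\int\log^2\frac{dP}{dQ}\,dP$ (both $+\infty$ if $P\not\ll Q$), and $$B_n(\theta^*,\varepsilon)=\{\theta\in\Theta:\ D(P_{\theta^*}^{(n)}\|P_\theta^{(n)})\le n\varepsilon^2,\ V(P_{\theta^*}^{(n)}\|P_\theta^{(n)})\le n\varepsilon^2\};$$ - the Rényi divergence $D_\alpha^{(n)}(\theta,\theta^*)=\frac{1}{\alpha-1}\log\int (p_\theta^{(n)})^\alpha (p_{\theta^*}^{(n)})^{1-\alpha}\,dy\in[0,\infty]$;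 - the $\alpha$-fractional posterior $P_\alpha(B\mid Y^{(n)})=\int_B p_\theta^{(n)}(Y^{(n)})^\alpha p_\theta(\theta)\,d\theta\big/\int_\Theta p_\theta^{(n)}(Y^{(n)})^\alpha p_\theta(\theta)\,d\theta$; - the GP-IVI family $\mathcal Q_{GP}=\{q_{\mu,\sigma}(\theta)=\int_0^1\phi_\sigma(\theta-\mu(\eta))\,d\eta:\ \mu\in C([0,1],\mathbb R^d),\ \sigma>0\}$, where $\phi_\sigma$ is the density of $N(0,\sigma^2I_d)$. For a family $\mathcal Q$ of probability densities on $\mathbb R^d$, an $\alpha$-VB minimiser over $\mathcal Q$ is a $\widehat q\in\mathcal Q$ at which $q\mapsto D(q\,\|\,P_\alpha(\cdot\mid Y^{(n)}))$ attains its minimum over $\mathcal Q$, the minimum being finite. Theorem. For all $\alpha\in(0,1)$ and $D>1$ there is a constant $C\ge 0$, depending only on $\alpha$ and $D$, such that for every model, prior and $\theta^*$ as above and all $n\ge1$ and $\varepsilon>0$ with $P_\theta[B_n(\theta^*,\varepsilon)]>0$, the following holds with $P_{\theta^*}^{(n)}$-probability at least $1-\frac{2}{(D-1)^2n\varepsilon^2}$: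 every $\alpha$-VB minimiser $\widehat q$ over $\mathcal Q_{GP}$ with $\widehat q\ll p_\theta$ satisfies $$\int\frac1n D_\alpha^{(n)}(\theta,\theta^*)\,\widehat q(\theta)\,d\theta\ \le\ \frac{D\alpha}{1-\alpha}\varepsilon^2+\frac{1}{n(1-\alpha)}\log\big\{P_\theta[B_n(\theta^*,\varepsilon)]^{-1}\big\}+\frac{C}{n}.$$ Thus GP-IVI attains the optimal $\alpha$-VB risk bound, namely that of the unrestricted variational family: on the same event the same inequality holds for every $\alpha$-VB minimiser $\widehat q\ll p_\theta$ over the family of all probability densities on $\mathbb R^d$. -/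

import Mathlib

open MeasureTheory
open scoped ENNReal

namespace GPIVI

noncomputable section

/-- Euclidean space `ℝᵏ`. -/
abbrev Vec (k : ℕ) := EuclideanSpace ℝ (Fin k)

/-- The measure on `ℝᵏ` with Lebesgue density `q`. -/
def densMeasure {k : ℕ} (q : Vec k → ℝ) : Measure (Vec k) :=
  volume.withDensity fun x => ENNReal.ofReal (q x)

/-- A dominated statistical model for one observation in `ℝᵖ`, with parameter set `Θ ⊆ ℝᵈ`,
Lebesgue densities `dens θ` (`θ ∈ Θ`), and a prior on `Θ` with Lebesgue density `prior`.
The values of `dens θ` for `θ ∉ Θ` are irrelevant. -/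
structure BayesModel (p d : ℕ) where
  Θ : Set (Vec d)
  measurableSet_Θ : MeasurableSet Θ
  dens : Vec d → Vec p → ℝ
  measurable_dens : Measurable (Function.uncurry dens)
  dens_nonneg : ∀ θ y, 0 ≤ dens θ y
  lintegral_dens : ∀ θ ∈ Θ, ∫⁻ y, ENNReal.ofReal (dens θ y) = 1
  prior : Vec d → ℝ
  measurable_prior : Measurable prior
  prior_nonneg : ∀ θ, 0 ≤ prior θ
  prior_eq_zero : ∀ θ, θ ∉ Θ → prior θ = 0
  lintegral_prior : ∫⁻ θ, ENNReal.ofReal (prior θ) = 1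

/-- `∫ (log (dμ/dν))² dμ`, with value `∞` if `μ` is not absolutely continuous w.r.t. `ν`. -/
def vDiv {X : Type*} [MeasurableSpace X] (μ ν : Measure X) : ℝ≥0∞ :=
  open Classical in
  if μ ≪ ν then ∫⁻ x, ENNReal.ofReal (llr μ ν x ^ 2) ∂μ else ∞

namespace BayesModel

variable {p d : ℕ} (M : BayesModel p d)

/-- The density `p(y | θ)` of `n` independent observations `y = (y₁, …, yₙ)`. -/
def lik (n : ℕ) (θ : Vec d) (y : Fin n → Vec p) : ℝ := ∏ i, M.dens θ (y i)

/-- The law of `n` independent observations with parameter `θ`. -/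
def law (n : ℕ) (θ : Vec d) : Measure (Fin n → Vec p) :=
  volume.withDensity fun y => ENNReal.ofReal (M.lik n θ y)

/-- The prior distribution of the parameter. -/
def priorMeasure : Measure (Vec d) := densMeasure M.prior

/-- The neighbourhood `Bₙ(θ₀, ε)` of `θ₀`, given by the Kullback-Leibler and the V-divergence of
the joint laws of the `n` observations. -/
def klBall (n : ℕ) (θ₀ : Vec d) (ε : ℝ) : Set (Vec d) :=
  {θ | θ ∈ M.Θ ∧
    InformationTheory.klDiv (M.law n θ₀) (M.law n θ) ≤ ENNReal.ofReal (n * ε ^ 2) ∧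
    vDiv (M.law n θ₀) (M.law n θ) ≤ ENNReal.ofReal (n * ε ^ 2)}

/-- The integral `∫ p(y | θ)^α p(y | θ₀)^(1 - α) dy`. -/
def affinity (α : ℝ) (n : ℕ) (θ θ₀ : Vec d) : ℝ≥0∞ :=
  ∫⁻ y, ENNReal.ofReal (M.lik n θ y ^ α * M.lik n θ₀ y ^ (1 - α))

/-- The Rényi divergence `(α - 1)⁻¹ log ∫ p(y | θ)^α p(y | θ₀)^(1 - α) dy` of order `α ∈ (0, 1)`
between the joint laws of the `n` observations under `θ` and under `θ₀`; it is `∞` when these are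
mutually singular. -/
def renyi (α : ℝ) (n : ℕ) (θ θ₀ : Vec d) : ℝ≥0∞ :=
  open Classical in
  if M.affinity α n θ θ₀ = 0 then ∞
  else ENNReal.ofReal ((α - 1)⁻¹ * Real.log (M.affinity α n θ θ₀).toReal)

/-- The unnormalised `α`-fractional posterior `B ↦ ∫_B p(y | θ)^α prior(θ) dθ`. -/
def fracUnnorm (α : ℝ) (n : ℕ) (y : Fin n → Vec p) : Measure (Vec d) :=
  densMeasure fun θ => M.lik n θ y ^ α * M.prior θ

/-- The `α`-fractional posterior given the data `y`. -/
def fracPosterior (α : ℝ) (n : ℕ) (y : Fin n → Vec p) : Measure (Vec d) :=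
  (M.fracUnnorm α n y Set.univ)⁻¹ • M.fracUnnorm α n y

/-- `q` minimises `D(q ‖ α-fractional posterior)` over the family `𝒬`, the minimum being finite. -/
def IsAlphaVBMinimiser (𝒬 : Set (Vec d → ℝ)) (α : ℝ) (n : ℕ) (y : Fin n → Vec p)
    (q : Vec d → ℝ) : Prop :=
  q ∈ 𝒬 ∧
  InformationTheory.klDiv (densMeasure q) (M.fracPosterior α n y) ≠ ∞ ∧
  ∀ q' ∈ 𝒬, InformationTheory.klDiv (densMeasure q) (M.fracPosterior α n y) ≤
    InformationTheory.klDiv (densMeasure q') (M.fracPosterior α n y)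

/-- The variational risk `∫ n⁻¹ D_α(θ, θ₀) q(θ) dθ`. -/
def risk (α : ℝ) (n : ℕ) (θ₀ : Vec d) (q : Vec d → ℝ) : ℝ≥0∞ :=
  ∫⁻ θ, M.renyi α n θ θ₀ / n ∂(densMeasure q)

end BayesModel

/-- The density of the normal distribution `N(0, σ² I_d)`. -/
def gaussDens {d : ℕ} (σ : ℝ) (t : Vec d) : ℝ :=
  (Real.sqrt (2 * Real.pi * σ ^ 2))⁻¹ ^ d * Real.exp (-‖t‖ ^ 2 / (2 * σ ^ 2))

/-- The implicit variational density `q_{μ,σ}(θ) = ∫₀¹ φ_σ(θ - μ(η)) dη`. -/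
def gpDens {d : ℕ} (μ : C(unitInterval, Vec d)) (σ : ℝ) (θ : Vec d) : ℝ :=
  ∫ η : unitInterval, gaussDens σ (θ - μ η)

/-- The GP-IVI variational family on `ℝᵈ`. -/
def gpFamily (d : ℕ) : Set (Vec d → ℝ) :=
  {q | ∃ (μ : C(unitInterval, Vec d)) (σ : ℝ), 0 < σ ∧ q = gpDens μ σ}

/-- The unrestricted variational family: all probability densities on `ℝᵈ`. -/
def allDensities (d : ℕ) : Set (Vec d → ℝ) :=
  {q | Measurable q ∧ (∀ θ, 0 ≤ q θ) ∧ ∫⁻ θ, ENNReal.ofReal (q θ) = 1}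

end

end GPIVI

namespace GPIVI
open InformationTheory Filter Topology

-- Quotients of densities as Radon-Nikodym derivatives.

section Densities

variable {X : Type*} [MeasurableSpace X] {μ : Measure X}

-- Write `a(θ)` for the affinity, so that `(1 - α) D_α = -log a`, and `ν` for the fractional
-- posterior. The Gibbs variational inequality `lintegral_neg_log_le_klDiv_add` gives `∫ -log a dq ≤
-- KL(q ‖ ν) + log ∫ a⁻¹ dν` for every `q ≪ ν`. It remains to bound the two terms on the right.
--
-- The integral `∫ a⁻¹ dν` is a quotient. Divided by `lik θ₀ ^ α`, its numerator has mean at most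
-- one under the true law, by Tonelli, so Markov's inequality controls it
-- (`law_lt_lintegral_div_affinity_le`). Its denominator, the normalising constant, is bounded below
-- by restricting the prior to the Kullback-Leibler ball, applying Jensen (`le_fracUnnorm_univ`) and
-- then Chebyshev to the averaged log-likelihood ratio (`measure_le_integral_le`). This produces the
-- prior mass term and the `ε ^ 2` term.
--
-- For a minimiser, `KL(q ‖ ν)` is at most that of any competitor, so a competitor with divergence
-- at most an absolute constant suffices. In the unrestricted family it is the posterior density
-- itself. In the GP-IVI family it comes from `exists_gpFamily_klDiv_lt`: the minimum is finite, so
-- some Gaussian envelope `exp (-b‖θ‖²)` has finite divergence from the posterior density `r`, and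
-- dominated convergence for the divergence holds below multiples of this envelope. Truncating `r`
-- at the envelope and normalising gives a density at most `2 r`, of divergence at most `1`. It is
-- then approximated by a continuous compactly supported density `G`, by a Gaussian smoothing of
-- `G`, and finally by a GP-IVI density: `G` is the law of a Borel map on `[0, 1]`, which is an a.e.
-- limit of continuous curves. The divergence stays below `2` throughout.

lemma withDensity_eq_withDensity_div {f g : X → ℝ≥0∞} (hf : Measurable f) (hg : Measurable g)
    (hg_top : ∀ x, g x ≠ ∞) (hfg : μ.withDensity f ≪ μ.withDensity g) :
    μ.withDensity f = (μ.withDensity g).withDensity (fun x => f x / g x) := by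
  change _ = (μ.withDensity g).withDensity (f / g)
  rw [← withDensity_mul μ hg (hf.div hg)]
  refine withDensity_congr_ae ?_
  -- The identity `f = g * (f / g)` can only fail where `g = 0`; absolute continuity makes `f`
  -- vanish a.e. there.
  have h0 : MeasurableSet {x | g x = 0} := hg (measurableSet_singleton 0)
  have h1 : μ.withDensity g {x | g x = 0} = 0 := by
    rw [withDensity_apply _ h0]
    exact setLIntegral_eq_zero h0 fun x hx => hx
  have h2 := hfg h1
  rw [withDensity_apply _ h0, lintegral_eq_zero_iff hf] at h2
  have h3 := (ae_restrict_iff' h0).1 h2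
  filter_upwards [h3] with x hx
  by_cases hgx : g x = 0
  · simp [hx hgx, hgx]
  · simp [ENNReal.mul_div_cancel hgx (hg_top x)]

lemma rnDeriv_withDensity_pair [SigmaFinite μ] {f g : X → ℝ≥0∞} (hf : Measurable f)
    (hg : Measurable g) (hg_top : ∀ x, g x ≠ ∞) (hfg : μ.withDensity f ≪ μ.withDensity g)
    [SigmaFinite (μ.withDensity g)] :
    (μ.withDensity f).rnDeriv (μ.withDensity g) =ᵐ[μ.withDensity g] fun x => f x / g x := by
  rw [withDensity_eq_withDensity_div hf hg hg_top hfg]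
  exact Measure.rnDeriv_withDensity _ (hf.div hg)

lemma withDensity_absolutelyContinuous_of_pos {f g : X → ℝ≥0∞} (hg : Measurable g)
    (hpos : ∀ᵐ x ∂μ, g x ≠ 0) : μ.withDensity f ≪ μ.withDensity g :=
  (withDensity_absolutelyContinuous μ f).trans
    (withDensity_absolutelyContinuous' hg.aemeasurable hpos)

end Densities

/-! ### Elementary inequalities for `klFun` -/

lemma klFun_le_one_add {x X : ℝ} (hx : 0 ≤ x) (hxX : x ≤ X) : klFun x ≤ 1 + klFun X := by
  have hX := klFun_nonneg (hx.trans hxX)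
  have h := convexOn_klFun.le_max_of_mem_Icc (x := 0) (y := X) (z := x) (by simp)
    (by simpa using hx.trans hxX) ⟨hx, hxX⟩
  rw [klFun_zero] at h
  exact h.trans (max_le (by linarith) (by linarith))

lemma klFun_le_one {x : ℝ} (hx : 0 ≤ x) (hx2 : x ≤ 2) : klFun x ≤ 1 := by
  have h := convexOn_klFun.le_max_of_mem_Icc (x := 0) (y := 2) (z := x) (by simp) (by simp)
    ⟨hx, hx2⟩
  rw [klFun_zero] at h
  refine h.trans (max_le le_rfl ?_)
  have := Real.log_two_lt_d9
  rw [klFun_apply]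
  linarith

lemma klFun_mul_le {C x : ℝ} (hC : 0 < C) (hx : 0 ≤ x) :
    klFun (C * x) ≤ C * klFun x + C * |Real.log C| * x + 1 := by
  rcases hx.eq_or_lt with rfl | hx
  · simp [klFun_zero, hC.le]
  · rw [klFun_apply, klFun_apply, Real.log_mul hC.ne' hx.ne']
    have h : C * x * Real.log C ≤ C * x * |Real.log C| := by
      gcongr
      exact le_abs_self _
    nlinarith

/-- The Young inequality behind the Gibbs variational principle. -/
lemma mul_le_klFun_add_exp {x g : ℝ} (hx : 0 ≤ x) : x * g + 1 ≤ klFun x + Real.exp g := by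
  rcases hx.eq_or_lt with rfl | hx
  · simpa [klFun_zero] using (Real.exp_pos g).le
  · have h := Real.add_one_le_exp (g - Real.log x)
    rw [Real.exp_sub, Real.exp_log hx, le_div_iff₀ hx] at h
    rw [klFun_apply]
    nlinarith

/-! ### The Kullback-Leibler divergence in terms of densities -/

section KLDens

variable {X : Type*} [MeasurableSpace X]

/-- The Kullback-Leibler divergence of the measures with densities `q` and `r`, for `r > 0`. -/
noncomputable def klDens (μ : Measure X) (q r : X → ℝ) : ℝ≥0∞ :=
  ∫⁻ x, ENNReal.ofReal (r x * klFun (q x / r x)) ∂μ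

variable {μ : Measure X}

/-- Positivity of `r` gives absolute continuity, with derivative `q / r`. The right side is an
integral of a nonnegative function against a fixed measure, so domination arguments apply to it, and
it also makes sense for unnormalised envelopes. -/
lemma klDiv_withDensity_eq_klDens [SigmaFinite μ] {q r : X → ℝ} (hq : Measurable q)
    (hr : Measurable r) (hq0 : ∀ x, 0 ≤ q x) (hrpos : ∀ᵐ x ∂μ, 0 < r x)
    (hqi : ∫⁻ x, ENNReal.ofReal (q x) ∂μ ≠ ∞) (hri : ∫⁻ x, ENNReal.ofReal (r x) ∂μ ≠ ∞) :
    klDiv (μ.withDensity fun x => ENNReal.ofReal (q x))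
      (μ.withDensity fun x => ENNReal.ofReal (r x)) = klDens μ q r := by
  have := isFiniteMeasure_withDensity hqi
  have := isFiniteMeasure_withDensity hri
  have hac : (μ.withDensity fun x => ENNReal.ofReal (q x)) ≪
      μ.withDensity fun x => ENNReal.ofReal (r x) :=
    withDensity_absolutelyContinuous_of_pos hr.ennreal_ofReal (by
      filter_upwards [hrpos] with x hx
      simpa using hx)
  rw [klDiv_eq_lintegral_klFun_of_ac hac]
  have h := rnDeriv_withDensity_pair hq.ennreal_ofReal hr.ennreal_ofReal
    (fun _ => ENNReal.ofReal_ne_top) hac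
  rw [lintegral_congr_ae (g := fun x => ENNReal.ofReal (klFun (q x / r x)))]
  · have hm : Measurable fun x => ENNReal.ofReal (klFun (q x / r x)) :=
      (measurable_klFun.comp (hq.div hr)).ennreal_ofReal
    rw [lintegral_withDensity_eq_lintegral_mul _ hr.ennreal_ofReal hm, klDens]
    refine lintegral_congr_ae ?_
    filter_upwards [hrpos] with x hx
    simp [ENNReal.ofReal_mul hx.le]
  · have hpos : ∀ᵐ x ∂(μ.withDensity fun x => ENNReal.ofReal (r x)), 0 < r x :=
      (withDensity_absolutelyContinuous μ _).ae_le hrpos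
    filter_upwards [h, hpos] with x hx hrx
    rw [hx, ENNReal.toReal_div, ENNReal.toReal_ofReal (hq0 x), ENNReal.toReal_ofReal hrx.le]

/-- The integrand of `klDens` at a smaller density. -/
lemma mul_klFun_div_le {q E r : ℝ} (hq : 0 ≤ q) (hqE : q ≤ E) (hr : 0 < r) :
    r * klFun (q / r) ≤ r + r * klFun (E / r) := by
  have := klFun_le_one_add (div_nonneg hq hr.le) (div_le_div_of_nonneg_right hqE hr.le)
  nlinarith

/-- `klFun` is not monotone, but by convexity it exceeds its value at a larger point by at most
`klFun 0 = 1`; integrated against `r` this costs only the mass of `r`. -/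
lemma klDens_ne_top_of_le {q E r : X → ℝ} (hr : Measurable r) (hrpos : ∀ᵐ x ∂μ, 0 < r x)
    (hri : ∫⁻ x, ENNReal.ofReal (r x) ∂μ ≠ ∞) (hq0 : ∀ x, 0 ≤ q x) (hqE : ∀ x, q x ≤ E x)
    (hE : klDens μ E r ≠ ∞) : klDens μ q r ≠ ∞ := by
  refine ne_top_of_le_ne_top (ENNReal.add_ne_top.2 ⟨hri, hE⟩) ?_
  rw [klDens, klDens, ← lintegral_add_left hr.ennreal_ofReal]
  refine lintegral_mono_ae ?_
  filter_upwards [hrpos] with x hx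
  rw [← ENNReal.ofReal_add hx.le
    (mul_nonneg hx.le (klFun_nonneg (div_nonneg ((hq0 x).trans (hqE x)) hx.le)))]
  exact ENNReal.ofReal_le_ofReal (mul_klFun_div_le (hq0 x) (hqE x) hx)

/-- Scaling the argument of `klFun` adds only an affine term, which integrates to a multiple of the
masses of `q` and `r`. -/
lemma klDens_const_mul_ne_top {q r : X → ℝ} (hr : Measurable r) (hq : Measurable q)
    (hrpos : ∀ᵐ x ∂μ, 0 < r x) (hri : ∫⁻ x, ENNReal.ofReal (r x) ∂μ ≠ ∞)
    (hqi : ∫⁻ x, ENNReal.ofReal (q x) ∂μ ≠ ∞) (hq0 : ∀ x, 0 ≤ q x) {C : ℝ} (hC : 0 < C)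
    (h : klDens μ q r ≠ ∞) : klDens μ (fun x => C * q x) r ≠ ∞ := by
  have hle : klDens μ (fun x => C * q x) r ≤ ∫⁻ x, (ENNReal.ofReal C *
      ENNReal.ofReal (r x * klFun (q x / r x)) +
      (ENNReal.ofReal (C * |Real.log C|) * ENNReal.ofReal (q x) + ENNReal.ofReal (r x))) ∂μ := by
    refine lintegral_mono_ae ?_
    filter_upwards [hrpos] with x hx
    have hk := klFun_nonneg (div_nonneg (hq0 x) hx.le)
    have hCC : 0 ≤ C * |Real.log C| := by positivity
    have hqx := hq0 x
    rw [← ENNReal.ofReal_mul hC.le, ← ENNReal.ofReal_mul hCC,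
      ← ENNReal.ofReal_add (by positivity) hx.le, ← ENNReal.ofReal_add (by positivity)
      (by positivity)]
    refine ENNReal.ofReal_le_ofReal ?_
    have := mul_le_mul_of_nonneg_left (klFun_mul_le hC (div_nonneg hqx hx.le)) hx.le
    rw [← mul_div_assoc] at this
    refine this.trans (le_of_eq ?_)
    field_simp
    ring
  refine ne_top_of_le_ne_top ?_ hle
  rw [lintegral_add_left (by
      exact ((hr.mul (measurable_klFun.comp (hq.div hr))).ennreal_ofReal).const_mul _),
    lintegral_add_left (hq.ennreal_ofReal.const_mul _),
    lintegral_const_mul' _ _ ENNReal.ofReal_ne_top, lintegral_const_mul' _ _ ENNReal.ofReal_ne_top]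
  exact ENNReal.add_ne_top.2 ⟨ENNReal.mul_ne_top ENNReal.ofReal_ne_top h,
    ENNReal.add_ne_top.2 ⟨ENNReal.mul_ne_top ENNReal.ofReal_ne_top hqi, hri⟩⟩

/-- Dominated convergence for the Kullback-Leibler divergence. -/
lemma tendsto_klDens {q : ℕ → X → ℝ} {h E r : X → ℝ} (hq : ∀ k, Measurable (q k))
    (hr : Measurable r) (hrpos : ∀ᵐ x ∂μ, 0 < r x) (hri : ∫⁻ x, ENNReal.ofReal (r x) ∂μ ≠ ∞)
    (hq0 : ∀ k x, 0 ≤ q k x) (hqE : ∀ k x, q k x ≤ E x) (hE : klDens μ E r ≠ ∞)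
    (hlim : ∀ᵐ x ∂μ, Tendsto (fun k => q k x) atTop (𝓝 (h x))) :
    Tendsto (fun k => klDens μ (q k) r) atTop (𝓝 (klDens μ h r)) := by
  refine tendsto_lintegral_of_dominated_convergence
    (fun x => ENNReal.ofReal (r x) + ENNReal.ofReal (r x * klFun (E x / r x))) ?_ ?_ ?_ ?_
  · exact fun k => (hr.mul (measurable_klFun.comp ((hq k).div hr))).ennreal_ofReal
  · intro k
    filter_upwards [hrpos] with x hx
    rw [← ENNReal.ofReal_add hx.le
      (mul_nonneg hx.le (klFun_nonneg (div_nonneg ((hq0 k x).trans (hqE k x)) hx.le)))]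
    exact ENNReal.ofReal_le_ofReal (mul_klFun_div_le (hq0 k x) (hqE k x) hx)
  · rw [lintegral_add_left hr.ennreal_ofReal]
    exact ENNReal.add_ne_top.2 ⟨hri, hE⟩
  · filter_upwards [hlim] with x hx
    exact (ENNReal.continuous_ofReal.tendsto _).comp
      (((continuous_klFun.tendsto _).comp (hx.div_const _)).const_mul _)

/-- A density that is at most twice `r` has divergence at most one from `r`. -/
lemma klDens_le_one {q r : X → ℝ} (hrpos : ∀ᵐ x ∂μ, 0 < r x)
    (hri : ∫⁻ x, ENNReal.ofReal (r x) ∂μ ≤ 1) (hq0 : ∀ x, 0 ≤ q x) (hqr : ∀ x, q x ≤ 2 * r x) :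
    klDens μ q r ≤ 1 := by
  refine le_trans (lintegral_mono_ae ?_) hri
  filter_upwards [hrpos] with x hx
  refine ENNReal.ofReal_le_ofReal (mul_le_of_le_one_right hx.le (klFun_le_one ?_ ?_))
  · exact div_nonneg (hq0 x) hx.le
  · rw [div_le_iff₀ hx]
    exact hqr x

end KLDens

end GPIVI

namespace GPIVI
open InformationTheory Filter Topology

/-! ### Gaussian densities -/

section Gauss

variable {d : ℕ}

lemma gaussDens_pos {σ : ℝ} (hσ : 0 < σ) (t : Vec d) : 0 < gaussDens σ t := by
  unfold gaussDens
  positivity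

lemma continuous_gaussDens (σ : ℝ) : Continuous (gaussDens σ : Vec d → ℝ) := by
  unfold gaussDens
  fun_prop

lemma integrable_exp_neg_mul_sq_norm {b : ℝ} (hb : 0 < b) :
    Integrable fun v : Vec d => Real.exp (-b * ‖v‖ ^ 2) := by
  have h := (GaussianFourier.integrable_cexp_neg_mul_sq_norm_add (V := Vec d) (b := (b : ℂ))
    (by simpa using hb) 0 0).norm
  refine h.congr (Eventually.of_forall fun v => ?_)
  simp [Complex.norm_exp, ← Complex.ofReal_pow]

lemma gaussDens_eq (σ : ℝ) (t : Vec d) : gaussDens σ t =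
    (Real.sqrt (2 * Real.pi * σ ^ 2))⁻¹ ^ d * Real.exp (-(2 * σ ^ 2)⁻¹ * ‖t‖ ^ 2) := by
  unfold gaussDens
  congr 2
  ring

lemma integrable_gaussDens {σ : ℝ} (hσ : 0 < σ) : Integrable (gaussDens σ : Vec d → ℝ) := by
  have h := (integrable_exp_neg_mul_sq_norm (d := d) (b := (2 * σ ^ 2)⁻¹)
    (by positivity)).const_mul ((Real.sqrt (2 * Real.pi * σ ^ 2))⁻¹ ^ d)
  exact h.congr (Eventually.of_forall fun t => (gaussDens_eq σ t).symm)

lemma integral_gaussDens {σ : ℝ} (hσ : 0 < σ) : ∫ t : Vec d, gaussDens σ t = 1 := by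
  simp_rw [gaussDens_eq]
  rw [integral_const_mul, GaussianFourier.integral_rexp_neg_mul_sq_norm (by positivity),
    finrank_euclideanSpace_fin, inv_pow, Real.sqrt_eq_rpow, ← Real.rpow_natCast, ← Real.rpow_mul
    (by positivity)]
  have h1 : Real.pi / (2 * σ ^ 2)⁻¹ = 2 * Real.pi * σ ^ 2 := by field_simp
  rw [h1, show (1 / 2 : ℝ) * d = d / 2 by ring, inv_mul_cancel₀ (by positivity)]

lemma sq_norm_le_two_mul (θ x : Vec d) : ‖θ‖ ^ 2 ≤ 2 * ‖θ - x‖ ^ 2 + 2 * ‖x‖ ^ 2 := by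
  have h := norm_add_le (θ - x) x
  rw [sub_add_cancel] at h
  nlinarith [norm_nonneg θ, sq_nonneg (‖θ - x‖ - ‖x‖), norm_nonneg x, norm_nonneg (θ - x)]

/-- The inequality `‖θ‖² ≤ 2‖θ - x‖² + 2‖x‖²` makes the envelope uniform over centres in a ball, at
the price of halving the exponential rate. The lower bound below uses it with the roles of `θ` and
`θ - x` exchanged and doubles the rate. -/
lemma gaussDens_sub_le {σ R : ℝ} (hσ : 0 < σ) {x : Vec d} (hx : ‖x‖ ≤ R) (θ : Vec d) :
    gaussDens σ (θ - x) ≤ (Real.sqrt (2 * Real.pi * σ ^ 2))⁻¹ ^ d *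
      Real.exp (R ^ 2 / (2 * σ ^ 2)) * Real.exp (-(4 * σ ^ 2)⁻¹ * ‖θ‖ ^ 2) := by
  rw [gaussDens, mul_assoc (_ ^ d), ← Real.exp_add]
  gcongr
  have h1 := sq_norm_le_two_mul θ x
  have h2 : ‖x‖ ^ 2 ≤ R ^ 2 := by gcongr
  have h3 : R ^ 2 / (2 * σ ^ 2) + -(4 * σ ^ 2)⁻¹ * ‖θ‖ ^ 2 =
      (2 * R ^ 2 - ‖θ‖ ^ 2) / 2 / (2 * σ ^ 2) := by
    field_simp
    ring
  rw [h3]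
  gcongr
  linarith

lemma le_gaussDens_sub {σ R : ℝ} (hσ : 0 < σ) {x : Vec d} (hx : ‖x‖ ≤ R) (θ : Vec d) :
    (Real.sqrt (2 * Real.pi * σ ^ 2))⁻¹ ^ d * Real.exp (-(R ^ 2 / σ ^ 2)) *
      Real.exp (-(σ ^ 2)⁻¹ * ‖θ‖ ^ 2) ≤ gaussDens σ (θ - x) := by
  rw [gaussDens, mul_assoc (_ ^ d), ← Real.exp_add]
  gcongr
  have h1 := sq_norm_le_two_mul (θ - x) (-x)
  rw [sub_neg_eq_add, sub_add_cancel, norm_neg] at h1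
  have h2 : ‖x‖ ^ 2 ≤ R ^ 2 := by gcongr
  have h3 : -(R ^ 2 / σ ^ 2) + -(σ ^ 2)⁻¹ * ‖θ‖ ^ 2 =
      (-(2 * R ^ 2) - 2 * ‖θ‖ ^ 2) / (2 * σ ^ 2) := by
    field_simp
    ring
  rw [h3]
  gcongr
  linarith

lemma gaussDens_smul {σ : ℝ} (hσ : 0 < σ) (z : Vec d) :
    σ ^ d * gaussDens σ (σ • z) = gaussDens 1 z := by
  rw [gaussDens, gaussDens, Real.sqrt_mul (by positivity), Real.sqrt_sq hσ.le, norm_smul, mul_inv,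
    mul_pow, Real.norm_of_nonneg hσ.le]
  have h1 : -(σ * ‖z‖) ^ 2 / (2 * σ ^ 2) = -‖z‖ ^ 2 / (2 * 1 ^ 2) := by
    field_simp
  have h2 : σ ^ d * σ⁻¹ ^ d = 1 := by
    rw [← mul_pow, mul_inv_cancel₀ hσ.ne', one_pow]
  rw [h1]
  simp only [one_pow, mul_one]
  linear_combination ((Real.sqrt (2 * Real.pi))⁻¹ ^ d * Real.exp (-‖z‖ ^ 2 / 2)) * h2

/-- The substitution `x = θ - σ z` moves `σ` into the argument of `G`, so that the limit `σ → 0` is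
taken against a fixed Gaussian. -/
lemma integral_gaussDens_sub_mul {σ : ℝ} (hσ : 0 < σ) (G : Vec d → ℝ) (θ : Vec d) :
    ∫ x, gaussDens σ (θ - x) * G x = ∫ z, G (θ - σ • z) * gaussDens 1 z := by
  rw [← integral_sub_left_eq_self (fun x => gaussDens σ (θ - x) * G x) volume θ]
  simp_rw [sub_sub_cancel]
  have h := Measure.integral_comp_smul (volume : Measure (Vec d))
    (fun y => gaussDens σ y * G (θ - y)) σ
  rw [finrank_euclideanSpace_fin, abs_of_pos (by positivity), smul_eq_mul,
    eq_inv_mul_iff_mul_eq₀ (by positivity), ← integral_const_mul] at h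
  rw [← h]
  congr 1 with z
  rw [← gaussDens_smul hσ z]
  ring

end Gauss

/-! ### The implicit variational densities -/

section GPDens

variable {d : ℕ}

lemma exists_norm_le (μ : C(unitInterval, Vec d)) : ∃ R, ∀ η, ‖μ η‖ ≤ R := by
  obtain ⟨R, hR⟩ := isCompact_univ.exists_bound_of_continuousOn μ.continuous.continuousOn
  exact ⟨R, fun η => hR η (Set.mem_univ η)⟩

lemma continuous_gaussDens_sub (μ : C(unitInterval, Vec d)) (σ : ℝ) :
    Continuous fun z : Vec d × unitInterval => gaussDens σ (z.1 - μ z.2) :=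
  (continuous_gaussDens σ).comp (continuous_fst.sub (μ.continuous.comp continuous_snd))

lemma integrable_gaussDens_sub (μ : C(unitInterval, Vec d)) (σ : ℝ) (θ : Vec d) :
    Integrable fun η => gaussDens σ (θ - μ η) :=
  (((continuous_gaussDens_sub μ σ).comp (by fun_prop : Continuous fun η => (θ, η)))
    ).integrable_of_hasCompactSupport (HasCompactSupport.of_compactSpace _)

lemma measurable_gpDens (μ : C(unitInterval, Vec d)) (σ : ℝ) : Measurable (gpDens μ σ) :=
  ((continuous_gaussDens_sub μ σ).stronglyMeasurable.integral_prod_right').measurable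

lemma gpDens_nonneg (μ : C(unitInterval, Vec d)) {σ : ℝ} (hσ : 0 < σ) (θ : Vec d) :
    0 ≤ gpDens μ σ θ :=
  integral_nonneg fun _ => (gaussDens_pos hσ _).le

lemma lintegral_gpDens (μ : C(unitInterval, Vec d)) {σ : ℝ} (hσ : 0 < σ) :
    ∫⁻ θ, ENNReal.ofReal (gpDens μ σ θ) = 1 := by
  have h1 : ∀ θ, ENNReal.ofReal (gpDens μ σ θ) =
      ∫⁻ η, ENNReal.ofReal (gaussDens σ (θ - μ η)) := fun θ =>
    ofReal_integral_eq_lintegral_ofReal (integrable_gaussDens_sub μ σ θ)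
      (Eventually.of_forall fun _ => (gaussDens_pos hσ _).le)
  simp_rw [h1]
  rw [lintegral_lintegral_swap]
  · have h2 : ∀ η, ∫⁻ θ, ENNReal.ofReal (gaussDens σ (θ - μ η)) = 1 := by
      intro η
      rw [lintegral_sub_right_eq_self (fun θ => ENNReal.ofReal (gaussDens σ θ)) (μ η),
        ← ofReal_integral_eq_lintegral_ofReal (integrable_gaussDens hσ)
          (Eventually.of_forall fun _ => (gaussDens_pos hσ _).le), integral_gaussDens hσ,
        ENNReal.ofReal_one]
    simp [h2]
  · exact (continuous_gaussDens_sub μ σ).measurable.ennreal_ofReal.aemeasurable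

/-- The Gaussian bounds are uniform along a bounded curve and survive averaging. The lower bound
transfers finite divergence from a GP-IVI density to a centred Gaussian envelope; `gpDens_le` gives
the domination. -/
lemma le_gpDens {μ : C(unitInterval, Vec d)} {σ R : ℝ} (hσ : 0 < σ) (hR : ∀ η, ‖μ η‖ ≤ R)
    (θ : Vec d) : (Real.sqrt (2 * Real.pi * σ ^ 2))⁻¹ ^ d * Real.exp (-(R ^ 2 / σ ^ 2)) *
      Real.exp (-(σ ^ 2)⁻¹ * ‖θ‖ ^ 2) ≤ gpDens μ σ θ := by
  have h := integral_mono (μ := (volume : Measure unitInterval)) (integrable_const _)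
    (integrable_gaussDens_sub μ σ θ) (fun η => le_gaussDens_sub hσ (hR η) θ)
  simpa [gpDens] using h

lemma gpDens_le {μ : C(unitInterval, Vec d)} {σ R : ℝ} (hσ : 0 < σ) (hR : ∀ η, ‖μ η‖ ≤ R)
    (θ : Vec d) : gpDens μ σ θ ≤ (Real.sqrt (2 * Real.pi * σ ^ 2))⁻¹ ^ d *
      Real.exp (R ^ 2 / (2 * σ ^ 2)) * Real.exp (-(4 * σ ^ 2)⁻¹ * ‖θ‖ ^ 2) := by
  have h := integral_mono (μ := (volume : Measure unitInterval)) (integrable_gaussDens_sub μ σ θ)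
    (integrable_const _) (fun η => gaussDens_sub_le hσ (hR η) θ)
  simpa [gpDens] using h

lemma gpDens_pos (μ : C(unitInterval, Vec d)) {σ : ℝ} (hσ : 0 < σ) (θ : Vec d) :
    0 < gpDens μ σ θ := by
  obtain ⟨R, hR⟩ := exists_norm_le μ
  exact lt_of_lt_of_le (by positivity) (le_gpDens hσ hR θ)

end GPDens

/-! ### Approximation by continuous functions -/

/-- Compactly supported continuous functions are dense in `L¹`; `L¹` convergence implies convergence
in measure, hence a.e. along a subsequence. -/
lemma exists_seq_continuous_tendsto_ae {X E : Type*} [TopologicalSpace X] [MeasurableSpace X]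
    [BorelSpace X] [NormalSpace X] [R1Space X] [WeaklyLocallyCompactSpace X]
    [NormedAddCommGroup E] [NormedSpace ℝ E] {μ : Measure X} [μ.Regular] {f : X → E}
    (hf : Integrable f μ) : ∃ g : ℕ → X → E, (∀ k, Continuous (g k)) ∧
      (∀ k, HasCompactSupport (g k)) ∧ ∀ᵐ x ∂μ, Tendsto (fun k => g k x) atTop (𝓝 (f x)) := by
  have h : ∀ k : ℕ, ∃ g : X → E, HasCompactSupport g ∧
      eLpNorm (f - g) 1 μ ≤ ENNReal.ofReal (1 / (k + 1)) ∧ Continuous g ∧ MemLp g 1 μ := fun k =>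
    (memLp_one_iff_integrable.2 hf).exists_hasCompactSupport_eLpNorm_sub_le ENNReal.one_ne_top
      (by simp; positivity)
  choose g hgs hg hgc hgm using h
  have hlim : Tendsto (fun k => eLpNorm (g k - f) 1 μ) atTop (𝓝 0) := by
    refine tendsto_of_tendsto_of_tendsto_of_le_of_le tendsto_const_nhds ?_ (fun _ => zero_le)
      (fun k => ?_) (h := fun k : ℕ => ENNReal.ofReal (1 / ((k : ℝ) + 1)))
    · simpa [Function.comp_def] using (ENNReal.continuous_ofReal.tendsto _).comp
        (tendsto_one_div_add_atTop_nhds_zero_nat (𝕜 := ℝ))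
    · rw [eLpNorm_sub_comm]
      exact hg k
  have hm := tendstoInMeasure_of_tendsto_eLpNorm one_ne_zero (fun k => (hgm k).1) hf.1 hlim
  obtain ⟨ns, -, hns⟩ := hm.exists_seq_tendsto_ae
  exact ⟨fun k => g (ns k), fun k => hgc _, fun k => hgs _, hns⟩

/-- The radial retraction onto the closed ball of radius `R`. -/
lemma exists_continuous_retraction {E : Type*} [NormedAddCommGroup E] [NormedSpace ℝ E] {R : ℝ}
    (hR : 0 < R) : ∃ ρ : E → E, Continuous ρ ∧ (∀ x, ‖ρ x‖ ≤ R) ∧ ∀ x, ‖x‖ ≤ R → ρ x = x := by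
  have hpos : ∀ x : E, 0 < max R ‖x‖ := fun x => lt_max_of_lt_left hR
  refine ⟨fun x => (R / max R ‖x‖) • x, ?_, fun x => ?_, fun x hx => ?_⟩
  · exact (continuous_const.div (by fun_prop) fun x => (hpos x).ne').smul continuous_id
  · rw [norm_smul, Real.norm_of_nonneg (div_nonneg hR.le (hpos x).le), div_mul_eq_mul_div,
      div_le_iff₀ (hpos x)]
    gcongr
    exact le_max_right _ _
  · simp [max_eq_left hx, div_self hR.ne']

end GPIVI

namespace GPIVI
open InformationTheory Filter Topology

/-! ### Approximation of a density by the GP-IVI family in Kullback-Leibler divergence -/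

section Approximation

variable {d : ℕ} {r : Vec d → ℝ}

lemma lintegral_ofReal_ne_top {X : Type*} [MeasurableSpace X] {μ : Measure X} {f : X → ℝ}
    (hf : Integrable f μ) : ∫⁻ x, ENNReal.ofReal (f x) ∂μ ≠ ∞ :=
  (hf.lintegral_lt_top).ne

lemma klDens_mul_exp_ne_top (hr : Measurable r) (hrpos : ∀ᵐ θ, 0 < r θ)
    (hri : ∫⁻ θ, ENNReal.ofReal (r θ) = 1) {b : ℝ} (hb : 0 < b)
    (hE : klDens volume (fun θ : Vec d => Real.exp (-b * ‖θ‖ ^ 2)) r ≠ ∞) {C : ℝ} (hC : 0 < C) :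
    klDens volume (fun θ : Vec d => C * Real.exp (-b * ‖θ‖ ^ 2)) r ≠ ∞ :=
  klDens_const_mul_ne_top hr (by fun_prop) hrpos (by simp [hri])
    (lintegral_ofReal_ne_top (integrable_exp_neg_mul_sq_norm hb)) (fun _ => (Real.exp_pos _).le) hC
    hE

/-- Truncating a probability density at a multiple of a positive function keeps at least half of
the mass if the multiple is large. -/
lemma exists_half_le_integral_min {X : Type*} [MeasurableSpace X] {μ : Measure X} {r E : X → ℝ}
    (hr : Measurable r) (hE : Measurable E) (hr0 : ∀ x, 0 ≤ r x) (hEpos : ∀ x, 0 < E x)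
    (hri : ∫⁻ x, ENNReal.ofReal (r x) ∂μ = 1) :
    ∃ k : ℝ, 0 < k ∧ 1 / 2 ≤ ∫ x, min (r x) (k * E x) ∂μ := by
  have hInt : Integrable r μ := by
    refine ⟨hr.aestronglyMeasurable, ?_⟩
    rw [hasFiniteIntegral_iff_ofReal (Eventually.of_forall hr0), hri]
    exact ENNReal.one_lt_top
  have h1 : ∫ x, r x ∂μ = 1 := by
    rw [integral_eq_lintegral_of_nonneg_ae (Eventually.of_forall hr0) hr.aestronglyMeasurable, hri,
      ENNReal.toReal_one]
  have hlim : Tendsto (fun k : ℕ => ∫ x, min (r x) (k * E x) ∂μ) atTop (𝓝 (∫ x, r x ∂μ)) := by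
    refine tendsto_integral_of_dominated_convergence r (fun k => ?_) hInt (fun k => ?_) ?_
    · exact (hr.min (hE.const_mul _)).aestronglyMeasurable
    · refine Eventually.of_forall fun x => ?_
      rw [Real.norm_of_nonneg (le_min (hr0 x) (mul_nonneg k.cast_nonneg (hEpos x).le))]
      exact min_le_left _ _
    · refine Eventually.of_forall fun x => ?_
      refine tendsto_const_nhds.congr' ?_
      filter_upwards [(tendsto_natCast_atTop_atTop (R := ℝ)).eventually_ge_atTop (r x / E x)]
        with k hk
      rw [div_le_iff₀ (hEpos x)] at hk
      exact (min_eq_left hk).symm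
  rw [h1] at hlim
  have hev := (hlim.eventually_const_lt (by norm_num : (1 / 2 : ℝ) < 1)).and
    (eventually_gt_atTop 0)
  obtain ⟨k, hk, hk0⟩ := hev.exists
  exact ⟨k, by exact_mod_cast hk0, hk.le⟩

/-- The function `min r (k E)` has mass at least `1 / 2`, so its normalisation is at most `2 r` and
has divergence at most `1`. Being below a multiple of `E`, it can be approximated in divergence by
continuous densities. -/
lemma exists_continuous_klDens_lt (hr : Measurable r) (hr0 : ∀ θ, 0 ≤ r θ)
    (hrpos : ∀ᵐ θ, 0 < r θ) (hri : ∫⁻ θ, ENNReal.ofReal (r θ) = 1) {b : ℝ} (hb : 0 < b)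
    (hE : klDens volume (fun θ : Vec d => Real.exp (-b * ‖θ‖ ^ 2)) r ≠ ∞) :
    ∃ G : Vec d → ℝ, Continuous G ∧ HasCompactSupport G ∧ (∀ θ, 0 ≤ G θ) ∧ ∫ θ, G θ = 1 ∧
      klDens volume G r < 2 := by
  set E : Vec d → ℝ := fun θ => Real.exp (-b * ‖θ‖ ^ 2) with hEdef
  have hEc : Continuous E := by fun_prop
  have hEpos : ∀ θ, 0 < E θ := fun θ => Real.exp_pos _
  have hEi : Integrable E := integrable_exp_neg_mul_sq_norm hb
  obtain ⟨k, hk0, hk⟩ := exists_half_le_integral_min hr hEc.measurable hr0 hEpos hri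
  set m : Vec d → ℝ := fun θ => min (r θ) (k * E θ) with hm
  have hm0 : ∀ θ, 0 ≤ m θ := fun θ => le_min (hr0 θ) (by have := hEpos θ; positivity)
  have hmm : Measurable m := hr.min (hEc.measurable.const_mul k)
  have hkE : Integrable fun θ => k * E θ := hEi.const_mul k
  have hmi : Integrable m := hkE.mono' hmm.aestronglyMeasurable
    (Eventually.of_forall fun θ => by
      rw [Real.norm_of_nonneg (hm0 θ)]
      exact min_le_right _ _)
  obtain ⟨g, hgc, hgs, hg⟩ := exists_seq_continuous_tendsto_ae hmi
  -- Clipping to `[0, k E]` keeps continuity and compact support and does not change the limit `m`,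
  -- which lies in this range; it supplies the envelope.
  set g' : ℕ → Vec d → ℝ := fun j θ => min (max (g j θ) 0) (k * E θ) with hg'
  have hg'c : ∀ j, Continuous (g' j) := fun j => by
    have := hgc j
    fun_prop
  have hg'0 : ∀ j θ, 0 ≤ g' j θ := fun j θ =>
    le_min (le_max_right _ _) (by have := hEpos θ; positivity)
  have hg's : ∀ j, HasCompactSupport (g' j) := fun j => (hgs j).mono fun θ hθ => by
    contrapose! hθ
    simp only [Function.mem_support, not_not] at hθ ⊢
    simp [hg', hθ, mul_nonneg hk0.le (hEpos θ).le]
  have hg'E : ∀ j θ, g' j θ ≤ k * E θ := fun j θ => min_le_right _ _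
  have hg'lim : ∀ᵐ θ, Tendsto (fun j => g' j θ) atTop (𝓝 (m θ)) := by
    filter_upwards [hg] with θ hθ
    have := (hθ.max (tendsto_const_nhds (x := (0 : ℝ)))).min
      (tendsto_const_nhds (x := k * E θ))
    rwa [max_eq_left (hm0 θ), min_eq_left (min_le_right _ _)] at this
  have hc : Tendsto (fun j => ∫ θ, g' j θ) atTop (𝓝 (∫ θ, m θ)) :=
    tendsto_integral_of_dominated_convergence (fun θ => k * E θ)
      (fun j => (hg'c j).aestronglyMeasurable) hkE
      (fun j => Eventually.of_forall fun θ => by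
        rw [Real.norm_of_nonneg (hg'0 j θ)]
        exact hg'E j θ) hg'lim
  -- Masses above `1 / 4` keep the normalised functions below `4 k E`.
  obtain ⟨J, hJ⟩ := eventually_atTop.1
    (hc.eventually_const_lt (lt_of_lt_of_le (by norm_num : (1 / 4 : ℝ) < 1 / 2) hk))
  have hcJ : ∀ j, 1 / 4 < ∫ θ, g' (j + J) θ := fun j => hJ _ (Nat.le_add_left _ _)
  have hlim := tendsto_klDens (μ := volume) (q := fun j θ => g' (j + J) θ / ∫ θ, g' (j + J) θ)
    (h := fun θ => m θ / ∫ θ, m θ) (E := fun θ => 4 * k * E θ)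
    (fun j => (hg'c _).measurable.div_const _) hr hrpos (by simp [hri])
    (fun j θ => div_nonneg (hg'0 _ _) (by have := hcJ j; linarith))
    (fun j θ => by
      have h1 := hcJ j
      rw [div_le_iff₀ (by linarith)]
      have h2 := hg'E (j + J) θ
      have h3 := mul_pos hk0 (hEpos θ)
      nlinarith)
    (klDens_mul_exp_ne_top hr hrpos hri hb hE (by positivity))
    (by
      filter_upwards [hg'lim] with θ hθ
      exact (hθ.comp (tendsto_add_atTop_nat J)).div (hc.comp (tendsto_add_atTop_nat J))
        (by linarith))
  have hle : klDens volume (fun θ => m θ / ∫ θ, m θ) r < 2 := by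
    refine lt_of_le_of_lt (klDens_le_one hrpos hri.le (fun θ => div_nonneg (hm0 θ) (by linarith))
      fun θ => ?_) (by norm_num)
    rw [div_le_iff₀ (by linarith)]
    have h1 : m θ ≤ r θ := min_le_left _ _
    have h2 := hr0 θ
    nlinarith
  obtain ⟨j, hj⟩ := (hlim.eventually_lt_const hle).exists
  have hcj := hcJ j
  refine ⟨_, (hg'c (j + J)).div_const _, ?_, fun θ => div_nonneg (hg'0 _ _) (by linarith), ?_, hj⟩
  · exact (hg's (j + J)).mono fun θ hθ => by
      contrapose! hθ
      simp only [Function.mem_support, not_not] at hθ ⊢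
      simp [hθ]
  · rw [integral_div, div_self (by linarith)]

/-- The smoothings converge pointwise to `G` as `σ → 0`. Compact support gives `G ≤ M exp
(-2b‖x‖²)`; half of this rate is lost in the convolution, which leaves the envelope `exp (-b‖θ‖²)`.
The condition `8 b σ² ≤ 1` limits the remaining loss to `exp (‖z‖² / 4)`, which the standard
Gaussian absorbs. -/
lemma exists_smoothing_klDens_lt (hr : Measurable r)
    (hrpos : ∀ᵐ θ, 0 < r θ) (hri : ∫⁻ θ, ENNReal.ofReal (r θ) = 1) {b : ℝ} (hb : 0 < b)
    (hE : klDens volume (fun θ : Vec d => Real.exp (-b * ‖θ‖ ^ 2)) r ≠ ∞) {G : Vec d → ℝ}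
    (hGc : Continuous G) (hGs : HasCompactSupport G) (hG0 : ∀ θ, 0 ≤ G θ)
    (hG : klDens volume G r < 2) :
    ∃ σ : ℝ, 0 < σ ∧ 8 * b * σ ^ 2 ≤ 1 ∧
      klDens volume (fun θ => ∫ x, gaussDens σ (θ - x) * G x) r < 2 := by
  obtain ⟨M, hM⟩ : ∃ M, ∀ x, ‖G x * Real.exp (2 * b * ‖x‖ ^ 2)‖ ≤ M :=
    (hGs.mul_right (f' := fun x => Real.exp (2 * b * ‖x‖ ^ 2))).exists_bound_of_continuous
      (by fun_prop)
  have hM0 : 0 ≤ M := (norm_nonneg _).trans (hM 0)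
  have hGM : ∀ x, G x ≤ M * Real.exp (-(2 * b) * ‖x‖ ^ 2) := fun x => by
    have h := (le_abs_self _).trans (hM x)
    rw [← le_div_iff₀ (Real.exp_pos _), div_eq_mul_inv, ← Real.exp_neg] at h
    simpa [neg_mul] using h
  have hGM' : ∀ x, G x ≤ M := fun x => (hGM x).trans (by
    refine mul_le_of_le_one_right hM0 (Real.exp_le_one_iff.2 ?_)
    have := mul_nonneg hb.le (sq_nonneg ‖x‖)
    linarith)
  set s : ℝ := (Real.sqrt (8 * b))⁻¹ with hs
  have hs0 : 0 < s := by positivity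
  have hs2 : 8 * b * s ^ 2 = 1 := by
    rw [hs, inv_pow, Real.sq_sqrt (by positivity), mul_inv_cancel₀ (by positivity)]
  set σ : ℕ → ℝ := fun k => s / (k + 1) with hσ
  have hσ0 : ∀ k, 0 < σ k := fun k => by positivity
  have hσs : ∀ k, σ k ≤ s := fun k => div_le_self hs0.le (by simp)
  have hσ2 : ∀ k, 8 * b * σ k ^ 2 ≤ 1 := fun k => by
    rw [← hs2]
    have := hσs k
    have := (hσ0 k).le
    gcongr
  have hσlim : Tendsto σ atTop (𝓝 0) := by
    have h := (tendsto_one_div_add_atTop_nhds_zero_nat (𝕜 := ℝ)).const_mul s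
    simpa [hσ, div_eq_mul_inv] using h
  have hφi := integrable_gaussDens (d := d) one_pos
  have hInt : ∀ (σ : ℝ) (θ : Vec d), Integrable fun z => G (θ - σ • z) * gaussDens 1 z :=
    fun σ θ => (hφi.const_mul M).mono'
      ((hGc.comp (by fun_prop)).mul (continuous_gaussDens 1)).aestronglyMeasurable
      (Eventually.of_forall fun z => by
        rw [Real.norm_of_nonneg (mul_nonneg (hG0 _) (gaussDens_pos one_pos _).le)]
        exact mul_le_mul_of_nonneg_right (hGM' _) (gaussDens_pos one_pos _).le)
  set I : ℝ := (Real.sqrt (2 * Real.pi * 1 ^ 2))⁻¹ ^ d *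
    ∫ z : Vec d, Real.exp (-(1 / 4) * ‖z‖ ^ 2) with hI
  have hI0 : 0 ≤ I := mul_nonneg (by positivity) (integral_nonneg fun _ => (Real.exp_pos _).le)
  -- The `+ 1` only makes the constant in the envelope positive.
  have hlim := tendsto_klDens (μ := volume) (q := fun k θ => ∫ x, gaussDens (σ k) (θ - x) * G x)
    (h := G) (E := fun θ => (M * I + 1) * Real.exp (-b * ‖θ‖ ^ 2)) (r := r)
    (fun k => by
      have h : Continuous fun z : Vec d × Vec d => gaussDens (σ k) (z.1 - z.2) * G z.2 :=
        ((continuous_gaussDens _).comp (by fun_prop)).mul (by fun_prop)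
      exact h.stronglyMeasurable.integral_prod_right'.measurable) hr hrpos (by simp [hri])
    (fun k θ => integral_nonneg fun x => mul_nonneg (gaussDens_pos (hσ0 k) _).le (hG0 x))
    (fun k θ => by
      rw [integral_gaussDens_sub_mul (hσ0 k)]
      have h : ∀ z, G (θ - σ k • z) * gaussDens 1 z ≤ M * Real.exp (-b * ‖θ‖ ^ 2) *
          ((Real.sqrt (2 * Real.pi * 1 ^ 2))⁻¹ ^ d * Real.exp (-(1 / 4) * ‖z‖ ^ 2)) := fun z => by
        rw [gaussDens_eq]
        have h1 : Real.exp (-(2 * b) * ‖θ - σ k • z‖ ^ 2) ≤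
            Real.exp (-b * ‖θ‖ ^ 2) * Real.exp (1 / 4 * ‖z‖ ^ 2) := by
          rw [← Real.exp_add, Real.exp_le_exp]
          have h2 := sq_norm_le_two_mul θ (σ k • z)
          rw [norm_smul, mul_pow, Real.norm_of_nonneg (hσ0 k).le] at h2
          have h3 := mul_le_mul_of_nonneg_left h2 hb.le
          have h4 := mul_le_mul_of_nonneg_right (hσ2 k) (sq_nonneg ‖z‖)
          linarith
        have h5 : Real.exp (-(2 * 1 ^ 2)⁻¹ * ‖z‖ ^ 2) =
            Real.exp (-(1 / 4) * ‖z‖ ^ 2) * Real.exp (-(1 / 4) * ‖z‖ ^ 2) := by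
          rw [← Real.exp_add]
          ring_nf
        have h6 : Real.exp (1 / 4 * ‖z‖ ^ 2) * Real.exp (-(1 / 4) * ‖z‖ ^ 2) = 1 := by
          rw [← Real.exp_add]
          simp
        calc G (θ - σ k • z) * ((Real.sqrt (2 * Real.pi * 1 ^ 2))⁻¹ ^ d *
              Real.exp (-(2 * 1 ^ 2)⁻¹ * ‖z‖ ^ 2))
            ≤ M * (Real.exp (-b * ‖θ‖ ^ 2) * Real.exp (1 / 4 * ‖z‖ ^ 2)) *
              ((Real.sqrt (2 * Real.pi * 1 ^ 2))⁻¹ ^ d *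
              Real.exp (-(2 * 1 ^ 2)⁻¹ * ‖z‖ ^ 2)) := by
              gcongr
              exact (hGM _).trans (by gcongr)
          _ = _ := by
              rw [h5]
              linear_combination (M * Real.exp (-b * ‖θ‖ ^ 2) *
                (Real.sqrt (2 * Real.pi * 1 ^ 2))⁻¹ ^ d * Real.exp (-(1 / 4) * ‖z‖ ^ 2)) * h6
      have h7 := integral_mono (hInt (σ k) θ) (((integrable_exp_neg_mul_sq_norm
        (by norm_num)).const_mul _).const_mul _) h
      refine h7.trans ?_
      rw [integral_const_mul, integral_const_mul, ← hI]
      nlinarith [Real.exp_pos (-b * ‖θ‖ ^ 2)])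
    (klDens_mul_exp_ne_top hr hrpos hri hb hE (by positivity))
    (Eventually.of_forall fun θ => by
      simp_rw [fun k => integral_gaussDens_sub_mul (hσ0 k) G θ]
      have h : G θ = ∫ z : Vec d, G θ * gaussDens 1 z := by
        rw [integral_const_mul, integral_gaussDens one_pos, mul_one]
      rw [h]
      refine tendsto_integral_of_dominated_convergence (fun z => M * gaussDens 1 z)
        (fun k => (hInt (σ k) θ).1) (hφi.const_mul M) (fun k => Eventually.of_forall fun z => ?_)
        (Eventually.of_forall fun z => ?_)
      · rw [Real.norm_of_nonneg (mul_nonneg (hG0 _) (gaussDens_pos one_pos _).le)]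
        exact mul_le_mul_of_nonneg_right (hGM' _) (gaussDens_pos one_pos _).le
      · have h1 : Tendsto (fun k => θ - σ k • z) atTop (𝓝 (θ - (0 : ℝ) • z)) :=
          tendsto_const_nhds.sub (hσlim.smul_const z)
        rw [zero_smul, sub_zero] at h1
        exact ((hGc.tendsto θ).comp h1).mul_const _)
  obtain ⟨k, hk⟩ := (hlim.eventually_lt_const hG).exists
  exact ⟨σ k, hσ0 k, hσ2 k, hk⟩

/-- Since `G` is the density of the image of the uniform law under a Borel map `f`, its smoothing is
a GP-IVI mixture with the possibly discontinuous curve `f`. Continuous curves tending to `f` a.e.,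
retracted to a ball containing almost all values of `f`, give mixtures under one common envelope. -/
lemma exists_gpDens_klDens_lt_of_smoothing (hr : Measurable r)
    (hrpos : ∀ᵐ θ, 0 < r θ) (hri : ∫⁻ θ, ENNReal.ofReal (r θ) = 1) {b : ℝ} (hb : 0 < b)
    (hE : klDens volume (fun θ : Vec d => Real.exp (-b * ‖θ‖ ^ 2)) r ≠ ∞) {G : Vec d → ℝ}
    (hGc : Continuous G) (hGs : HasCompactSupport G) (hG0 : ∀ θ, 0 ≤ G θ) (hGi : ∫ θ, G θ = 1)
    {σ : ℝ} (hσ : 0 < σ) (hbσ : 8 * b * σ ^ 2 ≤ 1)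
    (hh : klDens volume (fun θ => ∫ x, gaussDens σ (θ - x) * G x) r < 2) :
    ∃ μ : C(unitInterval, Vec d), klDens volume (gpDens μ σ) r < 2 := by
  have hGint : Integrable G := hGc.integrable_of_hasCompactSupport hGs
  have hprob : IsProbabilityMeasure (densMeasure G) := ⟨by
    rw [densMeasure, withDensity_apply _ MeasurableSet.univ, setLIntegral_univ,
      ← ofReal_integral_eq_lintegral_ofReal hGint (Eventually.of_forall hG0), hGi,
      ENNReal.ofReal_one]⟩
  obtain ⟨f, hfm, hf⟩ := Measure.exists_measurable_map_eq (densMeasure G)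
  obtain ⟨R, hR0, hR⟩ : ∃ R : ℝ, 0 < R ∧ ∀ x, R < ‖x‖ → G x = 0 := by
    obtain ⟨R, hR⟩ := hGs.isCompact.isBounded.subset_closedBall 0
    refine ⟨max R 1, by positivity, fun x hx => ?_⟩
    by_contra hne
    have h := hR (subset_tsupport _ hne)
    rw [mem_closedBall_zero_iff] at h
    exact absurd hx (not_lt.2 (h.trans (le_max_left _ _)))
  have hfR : ∀ᵐ η, ‖f η‖ ≤ R := by
    have h1 : ∀ᵐ x ∂(densMeasure G), ‖x‖ ≤ R := by
      rw [densMeasure, ae_withDensity_iff hGc.measurable.ennreal_ofReal]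
      refine Eventually.of_forall fun x hx => ?_
      by_contra hlt
      simp [hR x (not_le.1 hlt)] at hx
    rw [← hf] at h1
    exact ae_of_ae_map hfm.aemeasurable h1
  have hfi : Integrable f := (integrable_const R).mono' hfm.aestronglyMeasurable hfR
  obtain ⟨g, hgc, -, hg⟩ := exists_seq_continuous_tendsto_ae hfi
  obtain ⟨ρ, hρc, hρR, hρ⟩ := exists_continuous_retraction (E := Vec d) hR0
  let m : ℕ → C(unitInterval, Vec d) := fun k => ⟨fun η => ρ (g k η), hρc.comp (hgc k)⟩
  have hmlim : ∀ᵐ η, Tendsto (fun k => m k η) atTop (𝓝 (f η)) := by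
    filter_upwards [hg, hfR] with η h1 h2
    have h3 := (hρc.tendsto (f η)).comp h1
    rwa [hρ _ h2] at h3
  set C : ℝ := (Real.sqrt (2 * Real.pi * σ ^ 2))⁻¹ ^ d * Real.exp (R ^ 2 / (2 * σ ^ 2)) with hC
  have hC0 : 0 < C := by positivity
  have hmR : ∀ k η, ‖m k η‖ ≤ R := fun k η => hρR _
  have hlim := tendsto_klDens (μ := volume) (q := fun k => gpDens (m k) σ)
    (h := fun θ => ∫ x, gaussDens σ (θ - x) * G x) (E := fun θ => C * Real.exp (-b * ‖θ‖ ^ 2))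
    (r := r) (fun k => measurable_gpDens _ _) hr hrpos (by simp [hri])
    (fun k θ => gpDens_nonneg _ hσ θ)
    (fun k θ => (gpDens_le hσ (hmR k) θ).trans (by
      -- Here `8 b σ² ≤ 1` is used again: the mixtures decay at least as fast as the envelope.
      have : b ≤ (4 * σ ^ 2)⁻¹ := by
        rw [← one_div, le_div_iff₀ (by positivity)]
        nlinarith [mul_pos hb (pow_pos hσ 2)]
      rw [← hC]
      gcongr))
    (klDens_mul_exp_ne_top hr hrpos hri hb hE hC0)
    (Eventually.of_forall fun θ => by
      have h1 : ∫ x, gaussDens σ (θ - x) * G x = ∫ η, gaussDens σ (θ - f η) := by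
        have h2 : Continuous fun x => gaussDens σ (θ - x) :=
          (continuous_gaussDens σ).comp (by fun_prop)
        rw [← integral_map (f := fun x => gaussDens σ (θ - x)) hfm.aemeasurable
          h2.aestronglyMeasurable, hf, densMeasure,
          integral_withDensity_eq_integral_toReal_smul hGc.measurable.ennreal_ofReal
            (Eventually.of_forall fun _ => ENNReal.ofReal_lt_top)]
        congr 1 with x
        rw [ENNReal.toReal_ofReal (hG0 x), smul_eq_mul, mul_comm]
      rw [h1]
      refine tendsto_integral_of_dominated_convergence
        (fun _ => C * Real.exp (-(4 * σ ^ 2)⁻¹ * ‖θ‖ ^ 2))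
        (fun k => (integrable_gaussDens_sub (m k) σ θ).1) (integrable_const _)
        (fun k => Eventually.of_forall fun η => ?_) ?_
      · rw [Real.norm_of_nonneg (gaussDens_pos hσ _).le]
        exact gaussDens_sub_le hσ (hmR k η) θ
      · filter_upwards [hmlim] with η hη
        exact ((continuous_gaussDens σ).tendsto _).comp (tendsto_const_nhds.sub hη))
  obtain ⟨k, hk⟩ := (hlim.eventually_lt_const hh).exists
  exact ⟨m k, hk⟩

/-- If some member of the GP-IVI family has finite divergence from a probability density `r`, then
some member has divergence less than `2`. -/
theorem exists_gpFamily_klDiv_lt (hr : Measurable r) (hr0 : ∀ θ, 0 ≤ r θ)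
    (hri : ∫⁻ θ, ENNReal.ofReal (r θ) = 1) {q : Vec d → ℝ} (hq : q ∈ gpFamily d)
    (hqr : klDiv (densMeasure q) (densMeasure r) ≠ ∞) :
    ∃ q' ∈ gpFamily d, klDiv (densMeasure q') (densMeasure r) < 2 := by
  obtain ⟨μ, σ, hσ, rfl⟩ := hq
  -- GP-IVI densities are positive everywhere, so finite divergence forces Lebesgue measure to be
  -- absolutely continuous with respect to `r`.
  have hrpos : ∀ᵐ θ, 0 < r θ := by
    have hac := (klDiv_ne_top_iff.1 hqr).1
    have h1 : (volume : Measure (Vec d)) ≪ densMeasure (gpDens μ σ) :=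
      withDensity_absolutelyContinuous' (measurable_gpDens μ σ).ennreal_ofReal.aemeasurable
        (Eventually.of_forall fun θ => by simpa using gpDens_pos μ hσ θ)
    have h2 : ∀ᵐ θ ∂(densMeasure r), 0 < r θ := by
      rw [densMeasure, ae_withDensity_iff hr.ennreal_ofReal]
      exact Eventually.of_forall fun θ hθ => by simpa using hθ
    exact (h1.trans hac).ae_le h2
  have hkl : ∀ (μ : C(unitInterval, Vec d)) {σ : ℝ}, 0 < σ →
      klDiv (densMeasure (gpDens μ σ)) (densMeasure r) = klDens volume (gpDens μ σ) r :=
    fun μ σ hσ => klDiv_withDensity_eq_klDens (measurable_gpDens μ σ) hr (gpDens_nonneg μ hσ) hrpos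
      (by simp [lintegral_gpDens μ hσ]) (by simp [hri])
  rw [hkl μ hσ] at hqr
  obtain ⟨R, hR⟩ := exists_norm_le μ
  set c : ℝ := (Real.sqrt (2 * Real.pi * σ ^ 2))⁻¹ ^ d * Real.exp (-(R ^ 2 / σ ^ 2)) with hc
  have hc0 : 0 < c := by positivity
  have hb : 0 < (σ ^ 2)⁻¹ := by positivity
  have hE : klDens volume (fun θ : Vec d => Real.exp (-(σ ^ 2)⁻¹ * ‖θ‖ ^ 2)) r ≠ ∞ := by
    refine klDens_ne_top_of_le hr hrpos (by simp [hri]) (fun _ => (Real.exp_pos _).le)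
      (fun θ => ?_) (klDens_const_mul_ne_top hr (measurable_gpDens μ σ) hrpos (by simp [hri])
        (by simp [lintegral_gpDens μ hσ]) (gpDens_nonneg μ hσ) (inv_pos.2 hc0) hqr)
    rw [inv_mul_eq_div, le_div_iff₀ hc0, mul_comm]
    exact le_gpDens hσ hR θ
  obtain ⟨G, hGc, hGs, hG0, hGi, hG⟩ := exists_continuous_klDens_lt hr hr0 hrpos hri hb hE
  obtain ⟨τ, hτ, hbτ, hh⟩ := exists_smoothing_klDens_lt hr hrpos hri hb hE hGc hGs hG0 hG
  obtain ⟨μ', hμ'⟩ :=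
    exists_gpDens_klDens_lt_of_smoothing hr hrpos hri hb hE hGc hGs hG0 hGi hτ hbτ hh
  exact ⟨_, ⟨μ', τ, hτ, rfl⟩, by rwa [hkl μ' hτ]⟩

end Approximation

end GPIVI

namespace GPIVI
open InformationTheory Filter Topology

/-! ### The Gibbs variational inequality -/

/-- The Gibbs variational inequality for the function `-log a`, read as `∞` where `a = 0`. -/
lemma lintegral_neg_log_le_klDiv_add {X : Type*} [MeasurableSpace X] {Q ν : Measure X}
    [IsProbabilityMeasure Q] [IsProbabilityMeasure ν] (hQν : Q ≪ ν) {a G : X → ℝ≥0∞}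
    (ha : Measurable a) (hG : Measurable G) (ha1 : ∀ᵐ x ∂ν, a x ≤ 1)
    (hGa : ∀ x, a x ≠ 0 → G x = ENNReal.ofReal (-Real.log (a x).toReal)) {u : ℝ}
    (hu : ∫⁻ x, (a x)⁻¹ ∂ν ≤ ENNReal.ofReal u) :
    ∫⁻ x, G x ∂Q ≤ klDiv Q ν + ENNReal.ofReal (Real.log u) := by
  have hu1 : 1 ≤ u := by
    rw [← ENNReal.one_le_ofReal]
    refine le_trans ?_ hu
    calc (1 : ℝ≥0∞) = ∫⁻ _, 1 ∂ν := by simp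
      _ ≤ ∫⁻ x, (a x)⁻¹ ∂ν := lintegral_mono_ae (by
        filter_upwards [ha1] with x hx
        exact ENNReal.one_le_inv.2 hx)
  have hu0 : 0 < u := by linarith
  have ha0 : ∀ᵐ x ∂ν, a x ≠ 0 := by
    have h := ae_lt_top ha.inv (ne_top_of_le_ne_top ENNReal.ofReal_ne_top hu)
    filter_upwards [h] with x hx
    simpa [pos_iff_ne_zero] using hx
  have hx_top := Measure.rnDeriv_lt_top Q ν
  have hxm := Measure.measurable_rnDeriv Q ν
  have hai : Measurable fun x => (a x)⁻¹ := ha.inv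
  rw [← lintegral_rnDeriv_mul hQν hG.aemeasurable, klDiv_eq_lintegral_klFun_of_ac hQν]
  -- Adding `1` avoids subtraction in `ℝ≥0∞`: Young's inequality is applied with `g = -log a - log
  -- u`, and `∫ exp g dν ≤ 1` by the choice of `u`.
  refine ENNReal.le_of_add_le_add_right ENNReal.one_ne_top ?_
  calc ∫⁻ x, Q.rnDeriv ν x * G x ∂ν + 1 = ∫⁻ x, (Q.rnDeriv ν x * G x + 1) ∂ν := by
        rw [lintegral_add_right _ measurable_const]
        simp
    _ ≤ ∫⁻ x, (ENNReal.ofReal (klFun (Q.rnDeriv ν x).toReal) +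
          Q.rnDeriv ν x * ENNReal.ofReal (Real.log u) + (a x)⁻¹ * (ENNReal.ofReal u)⁻¹) ∂ν := by
        refine lintegral_mono_ae ?_
        filter_upwards [ha1, ha0, hx_top] with x h1 h0 hx
        rw [hGa x h0]
        obtain ⟨b, hb0, hb⟩ : ∃ b : ℝ, 0 < b ∧ a x = ENNReal.ofReal b :=
          ⟨(a x).toReal, ENNReal.toReal_pos h0 (ne_top_of_le_ne_top ENNReal.one_ne_top h1),
            (ENNReal.ofReal_toReal (ne_top_of_le_ne_top ENNReal.one_ne_top h1)).symm⟩
        have hb1 : b ≤ 1 := by rwa [hb, ENNReal.ofReal_le_one] at h1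
        obtain ⟨v, hv0, hv⟩ : ∃ v : ℝ, 0 ≤ v ∧ Q.rnDeriv ν x = ENNReal.ofReal v :=
          ⟨_, ENNReal.toReal_nonneg, (ENNReal.ofReal_toReal hx.ne).symm⟩
        have hlb : 0 ≤ -Real.log b := neg_nonneg.2 (Real.log_nonpos hb0.le hb1)
        have hlu := Real.log_nonneg hu1
        have hk := klFun_nonneg hv0
        rw [hb, hv, ENNReal.toReal_ofReal hb0.le, ENNReal.toReal_ofReal hv0,
          ← ENNReal.ofReal_inv_of_pos hb0, ← ENNReal.ofReal_inv_of_pos hu0,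
          ← ENNReal.ofReal_mul hv0, ← ENNReal.ofReal_mul hv0, ← ENNReal.ofReal_mul (by positivity),
          ← ENNReal.ofReal_one, ← ENNReal.ofReal_add (by positivity) zero_le_one,
          ← ENNReal.ofReal_add hk (by positivity), ← ENNReal.ofReal_add (by positivity)
          (by positivity)]
        refine ENNReal.ofReal_le_ofReal ?_
        have h := mul_le_klFun_add_exp (g := -Real.log b - Real.log u) hv0
        rw [Real.exp_sub, Real.exp_neg, Real.exp_log hb0, Real.exp_log hu0, div_eq_mul_inv] at h
        linarith
    _ = ∫⁻ x, ENNReal.ofReal (klFun (Q.rnDeriv ν x).toReal) ∂ν + ENNReal.ofReal (Real.log u) +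
          (∫⁻ x, (a x)⁻¹ ∂ν) * (ENNReal.ofReal u)⁻¹ := by
        rw [lintegral_add_right _ (hai.mul_const _), lintegral_add_right _ (hxm.mul_const _),
          lintegral_mul_const _ hxm, lintegral_mul_const _ hai, Measure.lintegral_rnDeriv hQν]
        simp
    _ ≤ _ := by
        gcongr
        refine (mul_le_mul_left hu _).trans ?_
        rw [ENNReal.mul_inv_cancel (by simpa using hu0) ENNReal.ofReal_ne_top]

/-! ### Measurability and normalisation -/

lemma densities_of_mem {d : ℕ} {𝒬 : Set (Vec d → ℝ)}
    (h𝒬 : 𝒬 = gpFamily d ∨ 𝒬 = allDensities d) {q : Vec d → ℝ} (hq : q ∈ 𝒬) :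
    q ∈ allDensities d := by
  rcases h𝒬 with rfl | rfl
  · obtain ⟨μ, σ, hσ, rfl⟩ := hq
    exact ⟨measurable_gpDens μ σ, gpDens_nonneg μ hσ, lintegral_gpDens μ hσ⟩
  · exact hq

lemma isProbabilityMeasure_densMeasure {d : ℕ} {q : Vec d → ℝ}
    (hq : ∫⁻ θ, ENNReal.ofReal (q θ) = 1) : IsProbabilityMeasure (densMeasure q) :=
  ⟨by rw [densMeasure, withDensity_apply _ MeasurableSet.univ, setLIntegral_univ, hq]⟩

namespace BayesModel

variable {p d : ℕ} (M : BayesModel p d) (n : ℕ)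

lemma measurable_lik_uncurry :
    Measurable fun z : Vec d × (Fin n → Vec p) => M.lik n z.1 z.2 := by
  unfold lik
  refine Finset.measurable_prod _ fun i _ => ?_
  exact M.measurable_dens.comp
    (measurable_fst.prodMk ((measurable_pi_apply i).comp measurable_snd))

lemma measurable_lik (θ : Vec d) : Measurable (M.lik n θ) :=
  (M.measurable_lik_uncurry n).comp measurable_prodMk_left

lemma measurable_lik_left (y : Fin n → Vec p) : Measurable fun θ => M.lik n θ y :=
  (M.measurable_lik_uncurry n).comp measurable_prodMk_right

lemma lik_nonneg (θ : Vec d) (y : Fin n → Vec p) : 0 ≤ M.lik n θ y :=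
  Finset.prod_nonneg fun i _ => M.dens_nonneg θ (y i)

lemma measurable_dens_right (θ : Vec d) : Measurable (M.dens θ) :=
  M.measurable_dens.comp measurable_prodMk_left

lemma integrable_dens {θ : Vec d} (hθ : θ ∈ M.Θ) : Integrable (M.dens θ) := by
  refine ⟨(M.measurable_dens_right θ).aestronglyMeasurable, ?_⟩
  rw [hasFiniteIntegral_iff_ofReal (Eventually.of_forall (M.dens_nonneg θ)), M.lintegral_dens θ hθ]
  exact ENNReal.one_lt_top

lemma lintegral_lik {θ : Vec d} (hθ : θ ∈ M.Θ) :
    ∫⁻ y, ENNReal.ofReal (M.lik n θ y) = 1 := by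
  have hi : Integrable (M.lik n θ) :=
    Integrable.fintype_prod (f := fun _ : Fin n => M.dens θ) fun _ => M.integrable_dens hθ
  have h1 : ∫ y, M.dens θ y = 1 := by
    rw [integral_eq_lintegral_of_nonneg_ae (Eventually.of_forall (M.dens_nonneg θ))
      (M.measurable_dens_right θ).aestronglyMeasurable, M.lintegral_dens θ hθ, ENNReal.toReal_one]
  rw [← ofReal_integral_eq_lintegral_ofReal hi (Eventually.of_forall (M.lik_nonneg n θ))]
  unfold lik
  rw [integral_fintype_prod_volume_eq_prod (f := fun _ : Fin n => M.dens θ)]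
  simp [h1]

lemma isProbabilityMeasure_law {θ : Vec d} (hθ : θ ∈ M.Θ) :
    IsProbabilityMeasure (M.law n θ) :=
  ⟨by rw [law, withDensity_apply _ MeasurableSet.univ, setLIntegral_univ, M.lintegral_lik n hθ]⟩

lemma isProbabilityMeasure_priorMeasure : IsProbabilityMeasure M.priorMeasure :=
  isProbabilityMeasure_densMeasure M.lintegral_prior

lemma ae_priorMeasure_mem : ∀ᵐ θ ∂M.priorMeasure, θ ∈ M.Θ := by
  rw [priorMeasure, densMeasure, ae_withDensity_iff M.measurable_prior.ennreal_ofReal]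
  refine Eventually.of_forall fun θ hθ => ?_
  by_contra hmem
  simp [M.prior_eq_zero θ hmem] at hθ

variable (α : ℝ) (θ₀ : Vec d)

lemma measurable_affinity : Measurable fun θ => M.affinity α n θ θ₀ := by
  unfold affinity
  refine Measurable.lintegral_prod_right' (f := fun z : Vec d × (Fin n → Vec p) =>
    ENNReal.ofReal (M.lik n z.1 z.2 ^ α * M.lik n θ₀ z.2 ^ (1 - α))) ?_
  exact (((M.measurable_lik_uncurry n).pow_const α).mul
    (((M.measurable_lik n θ₀).comp measurable_snd).pow_const _)).ennreal_ofReal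

lemma measurable_renyi : Measurable fun θ => M.renyi α n θ θ₀ := by
  unfold renyi
  refine Measurable.ite ((M.measurable_affinity n α θ₀) (measurableSet_singleton 0))
    measurable_const ?_
  exact ((Real.measurable_log.comp (M.measurable_affinity n α θ₀).ennreal_toReal).const_mul
    _).ennreal_ofReal

variable {α θ₀}

/-- Weighted AM-GM. Consequently the truncation by `ENNReal.ofReal` in `renyi` loses nothing on `Θ`.
-/
lemma affinity_le_one (hα₀ : 0 < α) (hα₁ : α < 1) {θ : Vec d} (hθ : θ ∈ M.Θ)
    (hθ₀ : θ₀ ∈ M.Θ) : M.affinity α n θ θ₀ ≤ 1 := by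
  have h : ∀ y, ENNReal.ofReal (M.lik n θ y ^ α * M.lik n θ₀ y ^ (1 - α)) ≤
      ENNReal.ofReal α * ENNReal.ofReal (M.lik n θ y) +
        ENNReal.ofReal (1 - α) * ENNReal.ofReal (M.lik n θ₀ y) := fun y => by
    have h1 := M.lik_nonneg n θ y
    have h2 := M.lik_nonneg n θ₀ y
    have h3 : 0 ≤ 1 - α := by linarith
    rw [← ENNReal.ofReal_mul hα₀.le, ← ENNReal.ofReal_mul h3, ← ENNReal.ofReal_add (by positivity)
      (by positivity)]
    exact ENNReal.ofReal_le_ofReal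
      (Real.geom_mean_le_arith_mean2_weighted hα₀.le h3 h1 h2 (by ring))
  refine (lintegral_mono h).trans ?_
  rw [lintegral_add_left ((M.measurable_lik n θ).ennreal_ofReal.const_mul _),
    lintegral_const_mul' _ _ ENNReal.ofReal_ne_top, lintegral_const_mul' _ _ ENNReal.ofReal_ne_top,
    M.lintegral_lik n hθ, M.lintegral_lik n hθ₀, mul_one, mul_one, ← ENNReal.ofReal_add hα₀.le
    (by linarith)]
  simp

/-! ### Variational minimisers -/

variable {n}

lemma measurable_fracDens (y : Fin n → Vec p) :
    Measurable fun θ => M.lik n θ y ^ α * M.prior θ :=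
  ((M.measurable_lik_left n y).pow_const α).mul M.measurable_prior

lemma fracUnnorm_univ (y : Fin n → Vec p) : M.fracUnnorm α n y Set.univ =
    ∫⁻ θ, ENNReal.ofReal (M.lik n θ y ^ α * M.prior θ) := by
  rw [fracUnnorm, densMeasure, withDensity_apply _ MeasurableSet.univ, setLIntegral_univ]

/-- With `∞⁻¹ = 0`, an infinite normalising constant would make `fracPosterior` the zero measure,
from which every probability measure has infinite divergence. -/
lemma fracUnnorm_univ_ne_top {𝒬 : Set (Vec d → ℝ)} (h𝒬 : 𝒬 = gpFamily d ∨ 𝒬 = allDensities d)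
    {y : Fin n → Vec p} {q : Vec d → ℝ} (hq : M.IsAlphaVBMinimiser 𝒬 α n y q) :
    M.fracUnnorm α n y Set.univ ≠ ∞ := by
  intro h
  have hprob := isProbabilityMeasure_densMeasure (densities_of_mem h𝒬 hq.1).2.2
  refine hq.2.1 ?_
  rw [fracPosterior, h, ENNReal.inv_top, zero_smul]
  exact klDiv_zero_right

lemma fracPosterior_eq_densMeasure {y : Fin n → Vec p} (h0 : M.fracUnnorm α n y Set.univ ≠ 0)
    (h1 : M.fracUnnorm α n y Set.univ ≠ ∞) : M.fracPosterior α n y = densMeasure fun θ =>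
      (M.fracUnnorm α n y Set.univ).toReal⁻¹ * (M.lik n θ y ^ α * M.prior θ) := by
  have hZ : 0 < (M.fracUnnorm α n y Set.univ).toReal := ENNReal.toReal_pos h0 h1
  rw [fracPosterior]
  conv_lhs => rw [← ENNReal.ofReal_toReal h1, ← ENNReal.ofReal_inv_of_pos hZ]
  conv_lhs => rw [fracUnnorm]
  rw [densMeasure, densMeasure, ← withDensity_smul _ (M.measurable_fracDens y).ennreal_ofReal]
  congr 1 with θ
  rw [Pi.smul_apply, smul_eq_mul, ← ENNReal.ofReal_mul (by positivity)]
  rfl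

/-- Minimisers over either family have bounded divergence from the fractional posterior. -/
lemma klDiv_le_two_of_isAlphaVBMinimiser {𝒬 : Set (Vec d → ℝ)}
    (h𝒬 : 𝒬 = gpFamily d ∨ 𝒬 = allDensities d) {y : Fin n → Vec p} {q : Vec d → ℝ}
    (hq : M.IsAlphaVBMinimiser 𝒬 α n y q) (h0 : M.fracUnnorm α n y Set.univ ≠ 0) :
    klDiv (densMeasure q) (M.fracPosterior α n y) ≤ 2 := by
  have h1 := M.fracUnnorm_univ_ne_top h𝒬 hq
  have hZ : 0 < (M.fracUnnorm α n y Set.univ).toReal := ENNReal.toReal_pos h0 h1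
  obtain ⟨hqm, hfin, hmin⟩ := hq
  rw [M.fracPosterior_eq_densMeasure h0 h1] at hfin hmin ⊢
  set r : Vec d → ℝ := fun θ =>
    (M.fracUnnorm α n y Set.univ).toReal⁻¹ * (M.lik n θ y ^ α * M.prior θ) with hr
  have hrm : Measurable r := (M.measurable_fracDens y).const_mul _
  have hr0 : ∀ θ, 0 ≤ r θ := fun θ => by
    have := M.lik_nonneg n θ y
    have := M.prior_nonneg θ
    positivity
  have hri : ∫⁻ θ, ENNReal.ofReal (r θ) = 1 := by
    simp_rw [hr, ENNReal.ofReal_mul (inv_nonneg.2 hZ.le)]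
    rw [lintegral_const_mul' _ _ ENNReal.ofReal_ne_top, ← M.fracUnnorm_univ,
      ENNReal.ofReal_inv_of_pos hZ, ENNReal.ofReal_toReal h1, ENNReal.inv_mul_cancel h0 h1]
  rcases h𝒬 with rfl | rfl
  · obtain ⟨q', hq', hlt⟩ := exists_gpFamily_klDiv_lt hrm hr0 hri hqm hfin
    exact (hmin q' hq').trans hlt.le
  · have := isProbabilityMeasure_densMeasure hri
    refine (hmin r ⟨hrm, hr0, hri⟩).trans ?_
    rw [klDiv_self]
    exact zero_le

/-- The risk bound for data at which the normalising constant of the fractional posterior is large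
and the prior average of `lik ^ α / affinity` is small. -/
lemma risk_le_of_isAlphaVBMinimiser (hα₀ : 0 < α) (hα₁ : α < 1) (hθ₀ : θ₀ ∈ M.Θ)
    {𝒬 : Set (Vec d → ℝ)} (h𝒬 : 𝒬 = gpFamily d ∨ 𝒬 = allDensities d) {y : Fin n → Vec p}
    {q : Vec d → ℝ} (hq : M.IsAlphaVBMinimiser 𝒬 α n y q)
    (hn : 1 ≤ n) {l x w : ℝ} (hl : 0 < l) (hx : 0 < x)
    (hw : 0 < w)
    (hX : ∫⁻ θ, ENNReal.ofReal (M.lik n θ y ^ α * M.prior θ) * (M.affinity α n θ θ₀)⁻¹ ≤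
      ENNReal.ofReal (l * x))
    (hZ : ENNReal.ofReal (l * w) ≤ M.fracUnnorm α n y Set.univ) :
    M.risk α n θ₀ q ≤ ENNReal.ofReal (1 / (n * (1 - α)) * (2 + Real.log (x / w))) := by
  have h0 : M.fracUnnorm α n y Set.univ ≠ 0 := by
    refine (lt_of_lt_of_le ?_ hZ).ne'
    simpa using mul_pos hl hw
  have h1 := M.fracUnnorm_univ_ne_top h𝒬 hq
  have hkl := M.klDiv_le_two_of_isAlphaVBMinimiser h𝒬 hq h0
  have hQ := isProbabilityMeasure_densMeasure (densities_of_mem h𝒬 hq.1).2.2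
  have hν : IsProbabilityMeasure (M.fracPosterior α n y) := ⟨by
    rw [fracPosterior, Measure.smul_apply, smul_eq_mul, ENNReal.inv_mul_cancel h0 h1]⟩
  have hQν : densMeasure q ≪ M.fracPosterior α n y := (klDiv_ne_top_iff.1 hq.2.1).1
  have hνprior : M.fracPosterior α n y ≪ M.priorMeasure := by
    rw [fracPosterior]
    refine Measure.smul_absolutelyContinuous.trans ?_
    have h : M.fracUnnorm α n y =
        M.priorMeasure.withDensity fun θ => ENNReal.ofReal (M.lik n θ y ^ α) := by
      rw [priorMeasure, densMeasure, ← withDensity_mul _ M.measurable_prior.ennreal_ofReal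
        ((M.measurable_lik_left n y).pow_const α).ennreal_ofReal, fracUnnorm, densMeasure]
      congr 1 with θ
      rw [Pi.mul_apply, mul_comm, ENNReal.ofReal_mul (M.prior_nonneg θ)]
    rw [h]
    exact withDensity_absolutelyContinuous _ _
  have haff : ∀ᵐ θ ∂(M.fracPosterior α n y), M.affinity α n θ θ₀ ≤ 1 := by
    filter_upwards [hνprior.ae_le M.ae_priorMeasure_mem] with θ hθ
    exact M.affinity_le_one n hα₀ hα₁ hθ hθ₀
  -- The factor `l`, later `lik θ₀ ^ α`, cancels between numerator and normalising constant.
  have hu : ∫⁻ θ, (M.affinity α n θ θ₀)⁻¹ ∂(M.fracPosterior α n y) ≤ ENNReal.ofReal (x / w) := by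
    have hai : Measurable fun θ => (M.affinity α n θ θ₀)⁻¹ := (M.measurable_affinity n α θ₀).inv
    rw [fracPosterior, lintegral_smul_measure, smul_eq_mul]
    conv_lhs => enter [2]; rw [fracUnnorm, densMeasure]
    rw [lintegral_withDensity_eq_lintegral_mul _ (M.measurable_fracDens y).ennreal_ofReal hai]
    calc _ ≤ (ENNReal.ofReal (l * w))⁻¹ * ENNReal.ofReal (l * x) := by
          gcongr
          exact hX
      _ = ENNReal.ofReal (x / w) := by
          rw [← ENNReal.ofReal_inv_of_pos (by positivity), ← ENNReal.ofReal_mul (by positivity)]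
          congr 1
          field_simp
  have hα' : 0 < 1 - α := by linarith
  have hn' : (0 : ℝ) < n := by exact_mod_cast hn
  set G : Vec d → ℝ≥0∞ := fun θ => ENNReal.ofReal (1 - α) * M.renyi α n θ θ₀ with hG
  have hDV := lintegral_neg_log_le_klDiv_add hQν (M.measurable_affinity n α θ₀) (G := G)
    ((M.measurable_renyi n α θ₀).const_mul _) haff (fun θ hθ => by
      rw [hG]
      simp only [renyi, if_neg hθ]
      rw [← ENNReal.ofReal_mul hα'.le]
      congr 1
      have : α - 1 ≠ 0 := by linarith
      field_simp
      ring) hu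
  have hrisk : M.risk α n θ₀ q = ENNReal.ofReal (1 / (n * (1 - α))) * ∫⁻ θ, G θ ∂(densMeasure q) := by
    rw [risk, ← lintegral_const_mul' _ _ ENNReal.ofReal_ne_top]
    refine lintegral_congr fun θ => ?_
    rw [hG]
    simp only
    rw [← mul_assoc, ← ENNReal.ofReal_mul (by positivity), div_eq_mul_inv, mul_comm]
    congr 1
    rw [show 1 / (n * (1 - α)) * (1 - α) = (n : ℝ)⁻¹ by field_simp, ENNReal.ofReal_inv_of_pos hn',
      ENNReal.ofReal_natCast]
  -- Nonnegativity lets `ENNReal.ofReal` split over the sum `2 + log (x / w)`.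
  have hxw : 0 ≤ Real.log (x / w) := by
    refine Real.log_nonneg ?_
    rw [← ENNReal.one_le_ofReal]
    refine le_trans ?_ hu
    calc (1 : ℝ≥0∞) = ∫⁻ _, 1 ∂(M.fracPosterior α n y) := by simp
      _ ≤ _ := lintegral_mono_ae (by
        filter_upwards [haff] with θ hθ
        exact ENNReal.one_le_inv.2 hθ)
  rw [hrisk, ENNReal.ofReal_mul (by positivity), ENNReal.ofReal_add zero_le_two hxw]
  gcongr
  refine hDV.trans ?_
  gcongr
  simpa using hkl

end BayesModel

end GPIVI

namespace GPIVI
open InformationTheory Filter Topology ProbabilityTheory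

/-! ### Jensen and Chebyshev inequalities for averages -/

lemma ofReal_exp_integral_le {X : Type*} [MeasurableSpace X] {β : Measure X}
    [IsProbabilityMeasure β] {f : X → ℝ} (hf : Integrable f β) :
    ENNReal.ofReal (Real.exp (∫ x, f x ∂β)) ≤ ∫⁻ x, ENNReal.ofReal (Real.exp (f x)) ∂β := by
  by_cases htop : ∫⁻ x, ENNReal.ofReal (Real.exp (f x)) ∂β = ∞
  · simp [htop]
  have hi : Integrable (fun x => Real.exp (f x)) β := by
    refine ⟨Real.continuous_exp.comp_aestronglyMeasurable hf.1, ?_⟩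
    rw [hasFiniteIntegral_iff_ofReal (Eventually.of_forall fun _ => (Real.exp_pos _).le)]
    exact lt_top_iff_ne_top.2 htop
  rw [← ofReal_integral_eq_lintegral_ofReal hi
    (Eventually.of_forall fun _ => (Real.exp_pos _).le)]
  exact ENNReal.ofReal_le_ofReal (convexOn_exp.map_integral_le Real.continuous_exp.continuousOn
    isClosed_univ (Eventually.of_forall fun _ => Set.mem_univ _) hf hi)

lemma sq_enorm_integral_le {X : Type*} [MeasurableSpace X] {β : Measure X}
    [IsProbabilityMeasure β] {f : X → ℝ} (hf : AEStronglyMeasurable f β) :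
    ‖∫ x, f x ∂β‖ₑ ^ 2 ≤ ∫⁻ x, ‖f x‖ₑ ^ 2 ∂β := by
  have h1 : ‖∫ x, f x ∂β‖ₑ ≤ eLpNorm f 2 β := by
    refine (enorm_integral_le_lintegral_enorm f).trans ?_
    rw [← eLpNorm_one_eq_lintegral_enorm]
    exact eLpNorm_le_eLpNorm_of_exponent_le (by norm_num) hf
  have h2 := eLpNorm_nnreal_pow_eq_lintegral (f := f) (μ := β) (p := 2) two_ne_zero
  norm_num at h2
  rw [← h2]
  gcongr

section Chebyshev

variable {T Y : Type*} [MeasurableSpace T] [MeasurableSpace Y] {β : Measure T} {P : Measure Y}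
  [IsProbabilityMeasure β] [IsProbabilityMeasure P] {L : T → Y → ℝ} {t : ℝ}

lemma integrable_prod_of_sq_le (hL : Measurable (Function.uncurry L))
    (h2 : ∀ᵐ θ ∂β, ∫⁻ y, ‖L θ y‖ₑ ^ 2 ∂P ≤ ENNReal.ofReal t) :
    Integrable (Function.uncurry L) (β.prod P) := by
  have hm : MemLp (Function.uncurry L) 2 (β.prod P) := by
    refine ⟨hL.aestronglyMeasurable, ?_⟩
    have h3 := eLpNorm_nnreal_pow_eq_lintegral (f := Function.uncurry L) (μ := β.prod P) (p := 2)
      two_ne_zero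
    norm_num at h3
    have h4 : eLpNorm (Function.uncurry L) 2 (β.prod P) ^ 2 < ∞ := by
      rw [h3, lintegral_prod _ (hL.enorm.pow_const 2).aemeasurable]
      refine lt_of_le_of_lt (lintegral_mono_ae h2) ?_
      simp
    by_contra htop
    rw [not_lt, top_le_iff] at htop
    simp [htop] at h4
  exact hm.integrable (by norm_num)

/-- Averaging over `β` preserves the mean bound by Fubini and the second-moment bound by
Cauchy-Schwarz and Tonelli. The variance is at most the second moment, so Chebyshev applies. -/
lemma measure_le_integral_le (hL : Measurable (Function.uncurry L)) (ht : 0 ≤ t)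
    (h2 : ∀ᵐ θ ∂β, ∫⁻ y, ‖L θ y‖ₑ ^ 2 ∂P ≤ ENNReal.ofReal t)
    (h1 : ∀ᵐ θ ∂β, ∫ y, L θ y ∂P ≤ t) {c : ℝ} (hc : 0 < c) :
    P {y | t + c ≤ ∫ θ, L θ y ∂β} ≤ ENNReal.ofReal (t / c ^ 2) := by
  have hInt := integrable_prod_of_sq_le hL h2
  set W : Y → ℝ := fun y => ∫ θ, L θ y ∂β with hW
  have hWm : StronglyMeasurable W :=
    hL.stronglyMeasurable.integral_prod_left'
  have hsq : ∫⁻ y, ‖W y‖ₑ ^ 2 ∂P ≤ ENNReal.ofReal t := by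
    calc ∫⁻ y, ‖W y‖ₑ ^ 2 ∂P ≤ ∫⁻ y, ∫⁻ θ, ‖L θ y‖ₑ ^ 2 ∂β ∂P :=
          lintegral_mono fun y => sq_enorm_integral_le
            (hL.comp measurable_prodMk_right).aestronglyMeasurable
      _ = ∫⁻ θ, ∫⁻ y, ‖L θ y‖ₑ ^ 2 ∂P ∂β := by
          rw [lintegral_lintegral_swap]
          exact ((hL.comp measurable_swap).enorm.pow_const 2).aemeasurable
      _ ≤ ∫⁻ _, ENNReal.ofReal t ∂β := lintegral_mono_ae h2
      _ = ENNReal.ofReal t := by simp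
  have hW2 : MemLp W 2 P := by
    refine ⟨hWm.aestronglyMeasurable, ?_⟩
    have h3 := eLpNorm_nnreal_pow_eq_lintegral (f := W) (μ := P) (p := 2) two_ne_zero
    norm_num at h3
    by_contra htop
    rw [not_lt, top_le_iff] at htop
    rw [← h3, htop] at hsq
    simp at hsq
  have hvar : variance W P ≤ t := by
    refine (variance_le_expectation_sq hWm.aestronglyMeasurable).trans ?_
    rw [integral_eq_lintegral_of_nonneg_ae (f := W ^ 2)
      (Eventually.of_forall fun y => sq_nonneg (W y)) (hWm.pow 2).aestronglyMeasurable]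
    refine ENNReal.toReal_le_of_le_ofReal ht (le_trans (le_of_eq ?_) hsq)
    refine lintegral_congr fun y => ?_
    rw [Pi.pow_apply, ← sq_abs, ENNReal.ofReal_pow (abs_nonneg _), ← Real.enorm_eq_ofReal_abs]
  have hmean : ∫ y, W y ∂P ≤ t := by
    have hswap : ∫ y, W y ∂P = ∫ θ, ∫ y, L θ y ∂P ∂β :=
      (integral_integral_swap hInt).symm
    rw [hswap]
    calc ∫ θ, ∫ y, L θ y ∂P ∂β ≤ ∫ _, t ∂β :=
          integral_mono_ae hInt.integral_prod_left (integrable_const _) h1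
      _ = t := by simp
  calc P {y | t + c ≤ W y} ≤ P {y | c ≤ |W y - ∫ y, W y ∂P|} := by
        refine measure_mono fun y hy => ?_
        simp only [Set.mem_ofPred_eq] at hy ⊢
        exact le_trans (by linarith) (le_abs_self _)
    _ ≤ ENNReal.ofReal (variance W P / c ^ 2) := meas_ge_le_variance_div_sq hW2 hc
    _ ≤ ENNReal.ofReal (t / c ^ 2) := by gcongr

end Chebyshev

-- Likelihood ratios on the prior neighbourhood, and bounds for the normalising constant and the
-- numerator.

namespace BayesModel

variable {p d : ℕ} (M : BayesModel p d) (n : ℕ)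

/-- The log-likelihood ratio `log (p(y | θ₀) / p(y | θ))`. -/
noncomputable def logRatio (θ₀ θ : Vec d) (y : Fin n → Vec p) : ℝ :=
  Real.log (M.lik n θ₀ y / M.lik n θ y)

lemma measurable_logRatio (θ₀ : Vec d) : Measurable (Function.uncurry (M.logRatio n θ₀)) :=
  Real.measurable_log.comp
    (((M.measurable_lik n θ₀).comp measurable_snd).div (M.measurable_lik_uncurry n))

/-- The measurable set of parameters with the moment bounds that define `klBall`. -/
def momentBall (θ₀ : Vec d) (t : ℝ) : Set (Vec d) :=
  {θ | θ ∈ M.Θ ∧ M.law n θ₀ {y | M.lik n θ y = 0} = 0 ∧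
    ∫⁻ y, ‖M.logRatio n θ₀ θ y‖ₑ ^ 2 ∂(M.law n θ₀) ≤ ENNReal.ofReal t ∧
    ∫ y, M.logRatio n θ₀ θ y ∂(M.law n θ₀) ≤ t}

variable {θ₀ : Vec d}

/-- Needed so that the prior conditioned on the ball is carried by it. `klBall` only has to be
contained in this set, since a larger prior mass improves the final bound. -/
lemma measurableSet_momentBall (hθ₀ : θ₀ ∈ M.Θ) (t : ℝ) :
    MeasurableSet (M.momentBall n θ₀ t) := by
  have := M.isProbabilityMeasure_law n hθ₀
  have hL := M.measurable_logRatio n θ₀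
  refine M.measurableSet_Θ.inter (MeasurableSet.inter ?_ (MeasurableSet.inter ?_ ?_))
  · have hS : MeasurableSet {z : Vec d × (Fin n → Vec p) | M.lik n z.1 z.2 = 0} :=
      (M.measurable_lik_uncurry n) (measurableSet_singleton 0)
    exact (measurable_measure_prodMk_left (ν := M.law n θ₀) hS) (measurableSet_singleton 0)
  · exact measurableSet_le ((hL.enorm.pow_const 2).lintegral_prod_right') measurable_const
  · exact measurableSet_le hL.stronglyMeasurable.integral_prod_right'.measurable measurable_const

lemma llr_law_ae_eq {θ : Vec d} (hθ : θ ∈ M.Θ) (hac : M.law n θ₀ ≪ M.law n θ) :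
    llr (M.law n θ₀) (M.law n θ) =ᵐ[M.law n θ₀] M.logRatio n θ₀ θ := by
  have hprob : IsProbabilityMeasure (volume.withDensity fun y => ENNReal.ofReal (M.lik n θ y)) :=
    M.isProbabilityMeasure_law n hθ
  have h := rnDeriv_withDensity_pair (μ := volume) (M.measurable_lik n θ₀).ennreal_ofReal
    (M.measurable_lik n θ).ennreal_ofReal (fun _ => ENNReal.ofReal_ne_top) hac
  filter_upwards [hac.ae_le h] with y hy
  rw [llr, law, law, hy, logRatio, ENNReal.toReal_div, ENNReal.toReal_ofReal (M.lik_nonneg n _ y),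
    ENNReal.toReal_ofReal (M.lik_nonneg n _ y)]

lemma klBall_subset_momentBall (hθ₀ : θ₀ ∈ M.Θ) (ε : ℝ) :
    M.klBall n θ₀ ε ⊆ M.momentBall n θ₀ (n * ε ^ 2) := by
  rintro θ ⟨hθ, hkl, hv⟩
  have := M.isProbabilityMeasure_law n hθ₀
  have := M.isProbabilityMeasure_law n hθ
  obtain ⟨hac, hInt⟩ := klDiv_ne_top_iff.1 (ne_top_of_le_ne_top ENNReal.ofReal_ne_top hkl)
  have hllr := M.llr_law_ae_eq n hθ hac
  refine ⟨hθ, hac ?_, ?_, ?_⟩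
  · have hS : MeasurableSet {y | M.lik n θ y = 0} :=
      (M.measurable_lik n θ) (measurableSet_singleton 0)
    rw [law, withDensity_apply _ hS]
    refine setLIntegral_eq_zero hS fun y hy => ?_
    rw [Set.mem_ofPred_eq] at hy
    simp [hy]
  · rw [vDiv, if_pos hac] at hv
    refine le_trans (le_of_eq (lintegral_congr_ae ?_)) hv
    filter_upwards [hllr] with y hy
    rw [hy, ← sq_abs (M.logRatio n θ₀ θ y), ENNReal.ofReal_pow (abs_nonneg _),
      ← Real.enorm_eq_ofReal_abs]
  · rw [← integral_congr_ae hllr, ← toReal_klDiv_of_measure_eq hac (by simp)]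
    exact ENNReal.toReal_le_of_le_ofReal (by positivity) hkl

lemma ae_law_lik_pos : ∀ᵐ y ∂(M.law n θ₀), 0 < M.lik n θ₀ y := by
  rw [law, ae_withDensity_iff (M.measurable_lik n θ₀).ennreal_ofReal]
  exact Eventually.of_forall fun y hy => by simpa using hy

variable {α : ℝ}

/-- A lower bound for the normalising constant of the fractional posterior. -/
lemma le_fracUnnorm_univ {S : Set (Vec d)} (hS0 : M.priorMeasure S ≠ 0)
    {y : Fin n → Vec p} (hy : 0 < M.lik n θ₀ y)
    (hpos : ∀ᵐ θ ∂(cond M.priorMeasure S), 0 < M.lik n θ y)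
    (hInt : Integrable (fun θ => M.logRatio n θ₀ θ y) (cond M.priorMeasure S)) :
    ENNReal.ofReal (M.lik n θ₀ y ^ α * ((M.priorMeasure S).toReal *
      Real.exp (-α * ∫ θ, M.logRatio n θ₀ θ y ∂(cond M.priorMeasure S)))) ≤
      M.fracUnnorm α n y Set.univ := by
  have := M.isProbabilityMeasure_priorMeasure
  have := cond_isProbabilityMeasure hS0
  have hSt : M.priorMeasure S ≠ ∞ := measure_ne_top _ _
  have hm : Measurable fun θ => ENNReal.ofReal (M.lik n θ y ^ α) :=
    ((M.measurable_lik_left n y).pow_const α).ennreal_ofReal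
  have h1 : M.fracUnnorm α n y Set.univ =
      ∫⁻ θ, ENNReal.ofReal (M.lik n θ y ^ α) ∂M.priorMeasure := by
    rw [M.fracUnnorm_univ, priorMeasure, densMeasure,
      lintegral_withDensity_eq_lintegral_mul _ M.measurable_prior.ennreal_ofReal hm]
    refine lintegral_congr fun θ => ?_
    rw [Pi.mul_apply, mul_comm, ENNReal.ofReal_mul (M.prior_nonneg θ)]
  have h2 : M.priorMeasure S * ∫⁻ θ, ENNReal.ofReal (M.lik n θ y ^ α) ∂(cond M.priorMeasure S) ≤
      ∫⁻ θ, ENNReal.ofReal (M.lik n θ y ^ α) ∂M.priorMeasure := by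
    rw [ProbabilityTheory.cond, lintegral_smul_measure, smul_eq_mul, ← mul_assoc,
      ENNReal.mul_inv_cancel hS0 hSt, one_mul]
    exact setLIntegral_le_lintegral _ _
  rw [h1]
  refine le_trans ?_ h2
  -- Factoring out `lik θ₀ ^ α` leaves the exponential of `-α * logRatio`, ready for Jensen.
  have h3 : ∫⁻ θ, ENNReal.ofReal (M.lik n θ y ^ α) ∂(cond M.priorMeasure S) =
      ENNReal.ofReal (M.lik n θ₀ y ^ α) *
        ∫⁻ θ, ENNReal.ofReal (Real.exp (-α * M.logRatio n θ₀ θ y)) ∂(cond M.priorMeasure S) := by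
    rw [← lintegral_const_mul' _ _ ENNReal.ofReal_ne_top]
    refine lintegral_congr_ae ?_
    filter_upwards [hpos] with θ hθ
    rw [← ENNReal.ofReal_mul (by positivity)]
    congr 1
    rw [logRatio, Real.log_div hy.ne' hθ.ne', Real.rpow_def_of_pos hy, Real.rpow_def_of_pos hθ,
      ← Real.exp_add]
    ring_nf
  rw [h3, ENNReal.ofReal_mul (by positivity), ENNReal.ofReal_mul ENNReal.toReal_nonneg,
    ENNReal.ofReal_toReal hSt, mul_left_comm]
  gcongr
  rw [← integral_const_mul]
  exact ofReal_exp_integral_le (hInt.const_mul _)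

/-- The Markov inequality for the prior average of `lik ^ α / affinity`. -/
lemma law_lt_lintegral_div_affinity_le {x : ℝ} (hx : 0 < x) :
    M.law n θ₀ {y | 0 < M.lik n θ₀ y ∧ ENNReal.ofReal (M.lik n θ₀ y ^ α * x) <
      ∫⁻ θ, ENNReal.ofReal (M.lik n θ y ^ α * M.prior θ) * (M.affinity α n θ θ₀)⁻¹} ≤
      ENNReal.ofReal (1 / x) := by
  set F : (Fin n → Vec p) → ℝ≥0∞ := fun y =>
    ∫⁻ θ, ENNReal.ofReal (M.lik n θ y ^ α * M.prior θ) * (M.affinity α n θ θ₀)⁻¹ with hF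
  have hai : Measurable fun θ => (M.affinity α n θ θ₀)⁻¹ := (M.measurable_affinity n α θ₀).inv
  have hjoint : Measurable fun z : Vec d × (Fin n → Vec p) =>
      ENNReal.ofReal (M.lik n z.1 z.2 ^ α * M.prior z.1) * (M.affinity α n z.1 θ₀)⁻¹ :=
    (((M.measurable_lik_uncurry n).pow_const α).mul
      (M.measurable_prior.comp measurable_fst)).ennreal_ofReal.mul (hai.comp measurable_fst)
  have hFm : Measurable F := hjoint.lintegral_prod_left'
  have hl0 := M.measurable_lik n θ₀
  set H : (Fin n → Vec p) → ℝ≥0∞ := fun y => F y * (ENNReal.ofReal (M.lik n θ₀ y ^ α))⁻¹ with hH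
  have hHm : Measurable H := hFm.mul (hl0.pow_const α).ennreal_ofReal.inv
  -- Since `lik θ₀ * lik θ₀ ^ (-α) = lik θ₀ ^ (1 - α)`, the inner integral over the data is the
  -- affinity, which cancels its inverse. Inequalities suffice where `lik θ₀` or the affinity
  -- vanishes.
  have hHi : ∫⁻ y, H y ∂(M.law n θ₀) ≤ 1 := by
    rw [law, lintegral_withDensity_eq_lintegral_mul _ hl0.ennreal_ofReal hHm]
    calc ∫⁻ y, ENNReal.ofReal (M.lik n θ₀ y) * H y
        ≤ ∫⁻ y, ENNReal.ofReal (M.lik n θ₀ y ^ (1 - α)) * F y := by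
          refine lintegral_mono fun y => ?_
          rcases (M.lik_nonneg n θ₀ y).eq_or_lt with h0 | h0
          · simp [← h0]
          · refine le_of_eq ?_
            rw [hH]
            simp only
            rw [mul_left_comm, mul_comm, ← ENNReal.ofReal_inv_of_pos (by positivity),
              ← ENNReal.ofReal_mul h0.le, Real.rpow_sub h0, Real.rpow_one, div_eq_mul_inv]
      _ = ∫⁻ y, ∫⁻ θ, ENNReal.ofReal (M.lik n θ₀ y ^ (1 - α)) *
            (ENNReal.ofReal (M.lik n θ y ^ α * M.prior θ) * (M.affinity α n θ θ₀)⁻¹) := by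
          refine lintegral_congr fun y => ?_
          rw [lintegral_const_mul' _ _ ENNReal.ofReal_ne_top]
      _ = ∫⁻ θ, ∫⁻ y, ENNReal.ofReal (M.lik n θ₀ y ^ (1 - α)) *
            (ENNReal.ofReal (M.lik n θ y ^ α * M.prior θ) * (M.affinity α n θ θ₀)⁻¹) := by
          rw [lintegral_lintegral_swap]
          exact (((hl0.pow_const (1 - α)).ennreal_ofReal.comp measurable_fst).mul
            (hjoint.comp measurable_swap)).aemeasurable
      _ = ∫⁻ θ, ENNReal.ofReal (M.prior θ) *
            ((M.affinity α n θ θ₀)⁻¹ * M.affinity α n θ θ₀) := by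
          refine lintegral_congr fun θ => ?_
          have hm : Measurable fun y =>
              ENNReal.ofReal (M.lik n θ y ^ α * M.lik n θ₀ y ^ (1 - α)) :=
            (((M.measurable_lik n θ).pow_const α).mul (hl0.pow_const _)).ennreal_ofReal
          rw [← mul_assoc, affinity, ← lintegral_const_mul _ hm]
          refine lintegral_congr fun y => ?_
          have h1 := M.lik_nonneg n θ y
          have h2 := M.lik_nonneg n θ₀ y
          rw [ENNReal.ofReal_mul (by positivity), ENNReal.ofReal_mul (by positivity)]
          ring
      _ ≤ ∫⁻ θ, ENNReal.ofReal (M.prior θ) := by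
          refine lintegral_mono fun θ => mul_le_of_le_one_right' ?_
          exact ENNReal.inv_mul_le_one _
      _ = 1 := M.lintegral_prior
  have hx' : ENNReal.ofReal x ≠ 0 := by simpa using hx
  calc _ ≤ M.law n θ₀ {y | ENNReal.ofReal x ≤ H y} := by
        refine measure_mono fun y hy => ?_
        obtain ⟨hy0, hy1⟩ := hy
        have hp : 0 < M.lik n θ₀ y ^ α := by positivity
        rw [Set.mem_ofPred_eq, hH]
        simp only
        rw [← div_eq_mul_inv, ENNReal.le_div_iff_mul_le (Or.inl (by simpa using hp))
          (Or.inl ENNReal.ofReal_ne_top), ← ENNReal.ofReal_mul hx.le, mul_comm]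
        exact hy1.le
    _ ≤ (∫⁻ y, H y ∂(M.law n θ₀)) / ENNReal.ofReal x :=
        meas_ge_le_lintegral_div hHm.aemeasurable hx' ENNReal.ofReal_ne_top
    _ ≤ 1 / ENNReal.ofReal x := by gcongr
    _ = ENNReal.ofReal (1 / x) := by
        rw [ENNReal.ofReal_div_of_pos hx, ENNReal.ofReal_one]

end BayesModel

end GPIVI

namespace GPIVI
open InformationTheory Filter Topology ProbabilityTheory

-- The high-probability event.

namespace BayesModel

variable {p d : ℕ} (M : BayesModel p d) (n : ℕ) {θ₀ : Vec d} {α : ℝ}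

/-- With high probability under the true law, the normalising constant of the fractional posterior
is large and the prior average of `lik ^ α / affinity` is small. -/
lemma exists_event (hθ₀ : θ₀ ∈ M.Θ) {t : ℝ}
    (hS0 : M.priorMeasure (M.momentBall n θ₀ t) ≠ 0) (ht : 0 ≤ t) {c x : ℝ} (hc : 0 < c) (hx : 0 < x) :
    ∃ A : Set (Fin n → Vec p), MeasurableSet A ∧
      1 - (ENNReal.ofReal (t / c ^ 2) + ENNReal.ofReal (1 / x)) ≤ M.law n θ₀ A ∧
      ∀ y ∈ A, 0 < M.lik n θ₀ y ∧
        ∫⁻ θ, ENNReal.ofReal (M.lik n θ y ^ α * M.prior θ) * (M.affinity α n θ θ₀)⁻¹ ≤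
          ENNReal.ofReal (M.lik n θ₀ y ^ α * x) ∧
        ∃ W < t + c, ENNReal.ofReal (M.lik n θ₀ y ^ α *
          ((M.priorMeasure (M.momentBall n θ₀ t)).toReal * Real.exp (-α * W))) ≤ M.fracUnnorm α n y Set.univ := by
  have := M.isProbabilityMeasure_law n hθ₀
  have := M.isProbabilityMeasure_priorMeasure
  have := cond_isProbabilityMeasure hS0
  set β := cond M.priorMeasure (M.momentBall n θ₀ t) with hβ
  have hβS : ∀ᵐ θ ∂β, θ ∈ M.momentBall n θ₀ t :=
    ae_cond_mem (M.measurableSet_momentBall n hθ₀ t)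
  have h2 : ∀ᵐ θ ∂β, ∫⁻ y, ‖M.logRatio n θ₀ θ y‖ₑ ^ 2 ∂(M.law n θ₀) ≤ ENNReal.ofReal t := by
    filter_upwards [hβS] with θ hθ using hθ.2.2.1
  have h1 : ∀ᵐ θ ∂β, ∫ y, M.logRatio n θ₀ θ y ∂(M.law n θ₀) ≤ t := by
    filter_upwards [hβS] with θ hθ using hθ.2.2.2
  have hL := M.measurable_logRatio n θ₀
  have hcheb := measure_le_integral_le hL ht h2 h1 hc
  have hInt : ∀ᵐ y ∂(M.law n θ₀), Integrable (fun θ => M.logRatio n θ₀ θ y) β :=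
    (integrable_prod_of_sq_le hL h2).prod_left_ae
  have hpos : ∀ᵐ y ∂(M.law n θ₀), ∀ᵐ θ ∂β, 0 < M.lik n θ y := by
    have hmeas : MeasurableSet {z : Vec d × (Fin n → Vec p) | 0 < M.lik n z.1 z.2} :=
      measurableSet_lt measurable_const (M.measurable_lik_uncurry n)
    refine Measure.ae_ae_comm (p := fun θ y => 0 < M.lik n θ y) hmeas |>.1 ?_
    filter_upwards [hβS] with θ hθ
    have h0 := hθ.2.1
    rw [ae_iff]
    refine measure_mono_null (fun y hy => ?_) h0
    exact le_antisymm (not_lt.1 hy) (M.lik_nonneg n θ y)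
  have hmarkov := M.law_lt_lintegral_div_affinity_le n (θ₀ := θ₀) (α := α) hx
  set bad₁ := {y | t + c ≤ ∫ θ, M.logRatio n θ₀ θ y ∂β} with hbad₁
  set bad₂ := {y | 0 < M.lik n θ₀ y ∧ ENNReal.ofReal (M.lik n θ₀ y ^ α * x) <
      ∫⁻ θ, ENNReal.ofReal (M.lik n θ y ^ α * M.prior θ) * (M.affinity α n θ θ₀)⁻¹} with hbad₂
  set good := {y | 0 < M.lik n θ₀ y ∧ (∀ᵐ θ ∂β, 0 < M.lik n θ y) ∧
    Integrable (fun θ => M.logRatio n θ₀ θ y) β} with hgood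
  have hnull : M.law n θ₀ goodᶜ = 0 := by
    have h : ∀ᵐ y ∂(M.law n θ₀), y ∈ good := by
      filter_upwards [M.ae_law_lik_pos n, hpos, hInt] with y h1 h2 h3 using ⟨h1, h2, h3⟩
    exact h
  set bad := goodᶜ ∪ (bad₁ ∪ bad₂) with hbad
  have hbadle : M.law n θ₀ bad ≤ ENNReal.ofReal (t / c ^ 2) + ENNReal.ofReal (1 / x) := by
    calc M.law n θ₀ bad ≤ M.law n θ₀ goodᶜ + (M.law n θ₀ bad₁ + M.law n θ₀ bad₂) :=
          (measure_union_le _ _).trans (by gcongr; exact measure_union_le _ _)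
      _ ≤ _ := by
          rw [hnull, zero_add]
          gcongr
  -- The measurable hull has the same measure as `bad`, so measurability of `bad` need not be shown.
  refine ⟨(toMeasurable (M.law n θ₀) bad)ᶜ, (measurableSet_toMeasurable _ _).compl, ?_, ?_⟩
  · rw [prob_compl_eq_one_sub (measurableSet_toMeasurable _ _), measure_toMeasurable]
    gcongr
  · intro y hy
    have hyb : y ∉ bad := fun h => hy (subset_toMeasurable _ _ h)
    simp only [hbad, Set.mem_union, Set.mem_compl_iff, not_or, not_not] at hyb
    obtain ⟨⟨hy0, hypos, hyInt⟩, hy1, hy2⟩ := hyb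
    refine ⟨hy0, ?_, ∫ θ, M.logRatio n θ₀ θ y ∂β, not_le.1 hy1,
      M.le_fracUnnorm_univ n hS0 hy0 hypos hyInt⟩
    by_contra hlt
    exact hy2 ⟨hy0, not_le.1 hlt⟩

end BayesModel

end GPIVI

-- Choice of constants and conclusion.

theorem theorem4p2 (α D : ℝ) (hα₀ : 0 < α) (hα₁ : α < 1) (hD : 1 < D) :
    ∃ C : ℝ, 0 ≤ C ∧
      ∀ (p d : ℕ) (M : GPIVI.BayesModel p d) (θ₀ : GPIVI.Vec d), θ₀ ∈ M.Θ →
      ∀ (n : ℕ) (ε : ℝ), 1 ≤ n → 0 < ε → 0 < M.priorMeasure (M.klBall n θ₀ ε) →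
      -- an event of probability at least `1 - 2 / ((D - 1)² n ε²)` under the true law of the data
      ∃ A : Set (Fin n → GPIVI.Vec p), MeasurableSet A ∧
        1 - ENNReal.ofReal (2 / ((D - 1) ^ 2 * n * ε ^ 2)) ≤ M.law n θ₀ A ∧
        -- the bound for GP-IVI, and the same bound for the unrestricted variational family
        ∀ 𝒬 : Set (GPIVI.Vec d → ℝ), 𝒬 = GPIVI.gpFamily d ∨ 𝒬 = GPIVI.allDensities d →
        ∀ y ∈ A, ∀ q : GPIVI.Vec d → ℝ, M.IsAlphaVBMinimiser 𝒬 α n y q →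
          GPIVI.densMeasure q ≪ M.priorMeasure →
          M.risk α n θ₀ q ≤ ENNReal.ofReal
            (D * α / (1 - α) * ε ^ 2
              + 1 / (n * (1 - α)) * Real.log ((M.priorMeasure (M.klBall n θ₀ ε)).toReal)⁻¹
              + C / n) := by
  have hα' : 0 < 1 - α := by linarith
  have hD' : 0 < D - 1 := by linarith
  -- The `2` bounds the divergence of the minimiser; the logarithm is what remains of `log x` from
  -- Markov's inequality.
  refine ⟨(2 + |Real.log (12 * (D - 1) / α)|) / (1 - α), by positivity, ?_⟩
  intro p d M θ₀ hθ₀ n ε hn hε hB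
  have hn' : (0 : ℝ) < n := by exact_mod_cast hn
  obtain ⟨t, ht⟩ : ∃ t : ℝ, t = n * ε ^ 2 := ⟨_, rfl⟩
  have ht0 : 0 < t := ht ▸ by positivity
  have hprior := M.isProbabilityMeasure_priorMeasure
  have hsub : M.klBall n θ₀ ε ⊆ M.momentBall n θ₀ t := ht ▸ M.klBall_subset_momentBall n hθ₀ ε
  have hle := MeasureTheory.measure_mono (μ := M.priorMeasure) hsub
  -- In units of `1 / ((D - 1)² t)`, Chebyshev costs `36 / 25` and Markov `1 / 2`, in total `97 / 50
  -- < 2`. Taking `5 / 6` of the slack `(D - 1) t` for the deviation leaves `1 / 6` to absorb the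
  -- growth of `log x` in `t`.
  obtain ⟨A, hA, hprob, hgood⟩ := M.exists_event n (α := α) hθ₀ (hB.trans_le hle).ne' ht0.le
    (c := 5 / 6 * (D - 1) * t) (x := 2 * (D - 1) ^ 2 * t) (by positivity) (by positivity)
  refine ⟨A, hA, le_trans ?_ hprob, ?_⟩
  · refine tsub_le_tsub_left ?_ 1
    rw [← ENNReal.ofReal_add (by positivity) (by positivity)]
    refine ENNReal.ofReal_le_ofReal ?_
    have h1 : t / (5 / 6 * (D - 1) * t) ^ 2 + 1 / (2 * (D - 1) ^ 2 * t) =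
        97 / 50 / ((D - 1) ^ 2 * t) := by
      field_simp
      norm_num
    rw [h1, mul_assoc, ← ht]
    gcongr
    norm_num
  · intro 𝒬 h𝒬 y hy q hq _
    obtain ⟨hl, hX, W, hW, hZ⟩ := hgood y hy
    have hP0 : 0 < (M.priorMeasure (M.klBall n θ₀ ε)).toReal :=
      ENNReal.toReal_pos hB.ne' (MeasureTheory.measure_ne_top _ _)
    have hP1 : (M.priorMeasure (M.klBall n θ₀ ε)).toReal ≤
        (M.priorMeasure (M.momentBall n θ₀ t)).toReal :=
      ENNReal.toReal_mono (MeasureTheory.measure_ne_top _ _) hle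
    have hS0 := hP0.trans_le hP1
    refine (M.risk_le_of_isAlphaVBMinimiser hα₀ hα₁ hθ₀ h𝒬 hq hn (Real.rpow_pos_of_pos hl α)
      (by positivity) (by positivity) hX hZ).trans (ENNReal.ofReal_le_ofReal ?_)
    have hlogP := Real.log_le_log hP0 hP1
    -- Splitting off `v = α (D - 1) t / 6` and using `log v ≤ v - 1` trades the logarithm of `t` for
    -- the reserved sixth plus a constant free of `n` and `ε`.
    have hlogx : Real.log (2 * (D - 1) ^ 2 * t) ≤
        |Real.log (12 * (D - 1) / α)| + α * (D - 1) * t / 6 := by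
      have hv : 0 < α * (D - 1) * t / 6 := by positivity
      have h1 : 2 * (D - 1) ^ 2 * t = 12 * (D - 1) / α * (α * (D - 1) * t / 6) := by
        field_simp
        norm_num
      rw [h1, Real.log_mul (by positivity) hv.ne']
      have h2 := Real.log_le_sub_one_of_pos hv
      have h3 := le_abs_self (Real.log (12 * (D - 1) / α))
      linarith
    rw [Real.log_div (by positivity) (by positivity), Real.log_mul hS0.ne' (Real.exp_pos _).ne',
      Real.log_exp, Real.log_inv]
    have hαW : α * W ≤ α * (t + 5 / 6 * (D - 1) * t) := mul_le_mul_of_nonneg_left hW.le hα₀.le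
    have hsum : 2 + (Real.log (2 * (D - 1) ^ 2 * t) -
        (Real.log (M.priorMeasure (M.momentBall n θ₀ t)).toReal + -α * W)) ≤
        D * α * t - Real.log (M.priorMeasure (M.klBall n θ₀ ε)).toReal +
          (2 + |Real.log (12 * (D - 1) / α)|) := by
      linarith
    refine (mul_le_mul_of_nonneg_left hsum (by positivity)).trans (le_of_eq ?_)
    rw [ht]
    field_simp
    ring
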